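/- **Setting.** Let $D,\beta,\gamma,\nu,\delta,\epsilon,\mu,\alpha\in\mathbb R$ with $(D,\beta)\neq(0,0)$, let $\psi:\mathbb R\to\mathbb C$ be measurable, and write $\boldsymbol\psi=(\operatorname{Re}\psi,\operatorname{Im}\psi)^T$. (In applications $\psi$ is the profile of a stationary pulse $e^{-i\alpha t}\psi(x)$ of the cubic-quintic complex Ginzburg-Landau equation $i\psi_t+\frac D2\psi_{xx}+\gamma|\psi|^2\psi+\nu|\psi|^4\psi=i\delta\psi+i\epsilon|\psi|^2\psi+i\beta\psi_{xx}+i\mu|\psi|^4\psi$; this is not needed for the statement.) For $a,b\in\mathbb R$ put $J(a,b)=\begin{bmatrix}a&-b\\b&a\end{bmatrix}$ and $$\mathbf B=J(\beta,\tfrac D2),\quad \mathbf N_0=J(\delta,\alpha),\quad \mathbf N_1=J(\epsilon,\gamma),\quad \mathbf N_2=J(\mu,\nu),$$ $$\widetilde{\mathbf M}(x)=\mathbf N_0+\mathbf N_1|\psi|^2+\mathbf N_2|\psi|^4+(2\mathbf N_1+4\mathbf N_2|\psi|^2)\boldsymbol\psi\boldsymbol\psi^T,\qquad \mathbf M=\widetilde{\mathbf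 M}-\mathbf N_0 .$$ Let $\mathcal L=\mathbf B\partial_x^2+\widetilde{\mathbf M}(x)$, as an operator in $L^2(\mathbb R,\mathbb C^2)$ with domain $H^2(\mathbb R,\mathbb C^2)$. Its essential spectrum $\sigma_{\rm ess}(\mathcal L)$ is the set of those $\lambda$ in the spectrum of $\mathcal L$ for which it is not the case that $\mathcal L-\lambda$ is Fredholm of index $0$ with $\operatorname{Ker}(\mathcal L-\lambda)\neq\{0\}$. For $\lambda\in\mathbb C$ put $$\mathbf A_\infty(\lambda)=\begin{bmatrix}0&\mathbf I\\ \mathbf B^{-1}(\lambda-\mathbf N_0)&0\end{bmatrix},\qquad \mathbf R(x)=\begin{bmatrix}0&0\\-\mathbf B^{-1}\mathbf M(x)&0\end{bmatrix}=\mathbf R_\ell(x)\mathbf R_r(x),$$ $$\mathbf R_\ell=\begin{bmatrix}0&0\\-\mathbf B^{-1}\mathbf M|\mathbf M|^{-1/2}&0\end{bmatrix},\qquad \mathbf R_r=\begin{bmatrix}|\mathbf M|^{1/2}&0\\0&0\end{bmatrix},\qquad |\mathbf M|=(\mathbf M^*\mathbf M)^{1/2},$$ where $|\mathbf M|^{-1/2}$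 is taken to be $0$ on $\ker|\mathbf M|$. Let $\mathbf Q(\lambda)$ be the spectral projection of $\mathbf A_\infty(\lambda)$ onto its stable subspace (the sum of the generalized eigenspaces for the eigenvalues with negative real part), let $$\mathbf G(x)=\begin{cases}-e^{\mathbf A_\infty(\lambda)x}\mathbf Q(\lambda),&x\ge0,\\ e^{\mathbf A_\infty(\lambda)x}(\mathbf I-\mathbf Q(\lambda)),&x<0,\end{cases}$$ and let $\mathcal K(\lambda)$ be the symmetrized Birman-Schwinger operator on $L^2(\mathbb R,\mathbb C^4)$, $$(\mathcal K(\lambda)\mathbf u)(x)=\mathbf R_r(x)\int_{\mathbb R}\mathbf G(x-y)\mathbf R_\ell(y)\mathbf u(y)\,dy .$$ For a Hilbert-Schmidt operator $\mathcal K$, ${\det}_2(\mathcal I+\mathcal K)$ is the $2$-modified Fredholm determinant: the continuous extension, in the Hilbert-Schmidt norm, of $\mathcal F\mapsto\det(\mathcal I+\mathcal F)e^{-\operatorname{Tr}\mathcal F}$ from the finite rank operators. Let $\|\cdot\|$ be the matrix $2$-norm and $\operatorname{cond}(\mathbf P)=\|\mathbf P\|\,\|\mathbf P^{-1}\|$.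 Put $a=\frac{\beta(\lambda-\delta)-D\alpha/2}{\det\mathbf B}$, $b=\frac{-[\frac D2(\lambda-\delta)+\alpha\beta]}{\det\mathbf B}$ and $\sigma_\pm=\sqrt{a\pm ib}$ (principal branch). Let $$\mathbf P(\lambda)=\begin{bmatrix} i/\sigma_-&-i/\sigma_+&i/\sigma_+&-i/\sigma_-\\-1/\sigma_-&-1/\sigma_+&1/\sigma_+&1/\sigma_-\\-i&i&i&-i\\1&1&1&1\end{bmatrix}\ \text{if }\sigma_+\ne\sigma_-,\qquad \mathbf P(\lambda)=\begin{bmatrix}0&1&0&1\\1&0&1&0\\0&-\sigma&0&\sigma\\-\sigma&0&\sigma&0\end{bmatrix}\ \text{if }\sigma_+=\sigma_-=\sigma .$$ **Theorem.** There is a universal constant $\Gamma>0$ such that the following holds for all parameters and all $\psi$ as above. Suppose that there are constants $C_R\in\mathbb R$ and $a_R>0$ with $$\|\mathbf R(x)\|\le C_Re^{-a_R|x|}\qquad\text{for all }x\in\mathbb R,$$ and that $\lambda\in\mathbb C\setminus\sigma_{\rm ess}(\mathcal L)$. Then $\mathbf P(\lambda)$ is invertible and $\mathbf P(\lambda)^{-1}\mathbf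 A_\infty(\lambda)\mathbf P(\lambda)$ is diagonal, the operator $\mathcal K(\lambda)$ is well defined, bounded and Hilbert-Schmidt, and $$|{\det}_2(\mathcal I+\mathcal K(\lambda))|\le\exp\left(\frac{32\,\Gamma\,C_R^2\operatorname{cond}^2(\mathbf P(\lambda))}{a_R^2}\right).$$ The same bound holds with $\mathbf P(\lambda)$ replaced by any invertible matrix $\mathbf P$ for which $\mathbf P^{-1}\mathbf A_\infty(\lambda)\mathbf P$ is diagonal. -/

import Mathlib

open MeasureTheory Filter Topology
open scoped ContDiff Matrix Matrix.Norms.L2Operator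

noncomputable section

namespace CGLE

/-! ### Hilbert-Schmidt operators and the 2-modified Fredholm determinant -/

section Determinant

variable {H : Type*} [NormedAddCommGroup H] [InnerProductSpace ℂ H]

/-- The square of the Hilbert-Schmidt norm, as an extended non-negative number: the supremum of
`∑ ‖T vᵢ‖²` over all finite orthonormal families. It equals `∑ ‖T eᵢ‖²` for every orthonormal
basis `e` of `H`. -/
def hsNormSq (T : H →L[ℂ] H) : ENNReal :=
  ⨆ (n : ℕ) (v : {v : Fin n → H // Orthonormal ℂ v}), ∑ i, ‖T (v.1 i)‖ₑ ^ 2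

/-- `T` is a Hilbert-Schmidt operator. -/
def IsHilbertSchmidt (T : H →L[ℂ] H) : Prop := hsNormSq T < ⊤

/-- `T` has finite rank. -/
def IsFiniteRank (T : H →L[ℂ] H) : Prop :=
  FiniteDimensional ℂ (LinearMap.range (T : H →ₗ[ℂ] H))

/-- The restriction of `T` to its range, as an endomorphism of the range. -/
def restrictRange (T : H →L[ℂ] H) :
    LinearMap.range (T : H →ₗ[ℂ] H) →ₗ[ℂ] LinearMap.range (T : H →ₗ[ℂ] H) :=
  (T : H →ₗ[ℂ] H).restrict fun x _ => LinearMap.mem_range_self (T : H →ₗ[ℂ] H) x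

/-- For a finite rank operator `F`, the number `det (I + F) * exp (- tr F)`; determinant and trace
are those of the restriction of `I + F`, respectively `F`, to the range of `F`. -/
def det2FiniteRank (F : H →L[ℂ] H) : ℂ :=
  LinearMap.det (1 + restrictRange F) * Complex.exp (-LinearMap.trace ℂ _ (restrictRange F))

/-- The 2-modified Fredholm determinant `det₂ (I + T)` of a Hilbert-Schmidt operator `T`: the
continuous extension of `F ↦ det (I + F) * exp (- tr F)` from the finite rank operators
with respect to the Hilbert-Schmidt norm, that is, the limit as `F → T` in this norm. -/
def det2 (T : H →L[ℂ] H) : ℂ :=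
  limUnder (comap (fun F : H →L[ℂ] H => hsNormSq (F - T)) (𝓝 0) ⊓ 𝓟 {F | IsFiniteRank F})
    det2FiniteRank

end Determinant

/-! ### Spectra of unbounded operators -/

section Spectrum

variable {H : Type*} [NormedAddCommGroup H] [NormedSpace ℂ H]

/-- The map `T - lam` on the domain of `T`. -/
def shift (T : H →ₗ.[ℂ] H) (lam : ℂ) : T.domain →ₗ[ℂ] H :=
  T.toFun - lam • T.domain.subtype

/-- The resolvent set: `T - lam` is a bijection from the domain of `T` onto `H`, with bounded
inverse. -/
def resolventSet (T : H →ₗ.[ℂ] H) : Set ℂ :=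
  {lam | ∃ S : H →L[ℂ] H, (∀ p : T.domain, S (shift T lam p) = p) ∧
    ∀ f : H, ∃ h : S f ∈ T.domain, shift T lam ⟨S f, h⟩ = f}

/-- The Fredholm point spectrum: `T - lam` is Fredholm (finite dimensional kernel, closed range of
finite codimension) of index zero, and has a non-trivial kernel. -/
def fredholmPointSpectrum (T : H →ₗ.[ℂ] H) : Set ℂ :=
  {lam | FiniteDimensional ℂ (LinearMap.ker (shift T lam)) ∧
    IsClosed (LinearMap.range (shift T lam) : Set H) ∧
    FiniteDimensional ℂ (H ⧸ LinearMap.range (shift T lam)) ∧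
    Module.finrank ℂ (LinearMap.ker (shift T lam)) =
      Module.finrank ℂ (H ⧸ LinearMap.range (shift T lam)) ∧
    LinearMap.ker (shift T lam) ≠ ⊥}

/-- The essential spectrum: the spectrum without the Fredholm point spectrum. -/
def essentialSpectrum (T : H →ₗ.[ℂ] H) : Set ℂ :=
  (resolventSet T)ᶜ \ fredholmPointSpectrum T

end Spectrum

/-! ### The linearized operator -/

/-- The space `L²(ℝ, ℂⁿ)`, where `n` is a finite index type. -/
abbrev L2 (n : Type) [Fintype n] : Type := Lp (EuclideanSpace ℂ n) 2 (volume : Measure ℝ)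

/-- The action of a matrix on a vector of the Euclidean space `ℂⁿ`. -/
def act {n : Type} [Fintype n] [DecidableEq n] (A : Matrix n n ℂ) (v : EuclideanSpace ℂ n) :
    EuclideanSpace ℂ n :=
  Matrix.toEuclideanCLM (𝕜 := ℂ) A v

/-- `v` is the weak derivative of `u`. -/
def HasWeakDeriv {n : Type} [Fintype n] (u v : L2 n) : Prop :=
  ∀ φ : ℝ → ℝ, ContDiff ℝ ∞ φ → HasCompactSupport φ →
    ∫ x, deriv φ x • u x = -∫ x, φ x • v x

/-- The real parameters of the equation
`i ψ_t + (D/2) ψ_xx + γ |ψ|² ψ + ν |ψ|⁴ ψ = i δ ψ + i ε |ψ|² ψ + i β ψ_xx + i μ |ψ|⁴ ψ`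
and the phase change `α` of the solution `exp (-i α t) ψ(x)`. -/
structure Params where
  D : ℝ
  β : ℝ
  γ : ℝ
  ν : ℝ
  δ : ℝ
  ε : ℝ
  μ : ℝ
  α : ℝ

variable (p : Params) (ψ : ℝ → ℂ) (lam : ℂ)

/-- The real matrix with rows `(a, -b)` and `(b, a)`. -/
def rot (a b : ℝ) : Matrix (Fin 2) (Fin 2) ℂ := !![(a : ℂ), -(b : ℂ); (b : ℂ), (a : ℂ)]

/-- The matrix `B`. -/
def matB : Matrix (Fin 2) (Fin 2) ℂ := rot p.β (p.D / 2)

/-- The matrix `N₀`. -/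
def matN0 : Matrix (Fin 2) (Fin 2) ℂ := rot p.δ p.α

/-- The matrix `N₁`. -/
def matN1 : Matrix (Fin 2) (Fin 2) ℂ := rot p.ε p.γ

/-- The matrix `N₂`. -/
def matN2 : Matrix (Fin 2) (Fin 2) ℂ := rot p.μ p.ν

/-- The real vector `(Re ψ(x), Im ψ(x))`. -/
def psiVec (x : ℝ) : Fin 2 → ℂ := ![((ψ x).re : ℂ), ((ψ x).im : ℂ)]

/-- The matrix
`M̃(x) = N₀ + |ψ|² N₁ + |ψ|⁴ N₂ + (2 N₁ + 4 |ψ|² N₂) ψ ψᵀ`. -/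
def matMtilde (x : ℝ) : Matrix (Fin 2) (Fin 2) ℂ :=
  matN0 p + ((‖ψ x‖ : ℂ) ^ 2) • matN1 p + ((‖ψ x‖ : ℂ) ^ 4) • matN2 p +
    ((2 : ℂ) • matN1 p + (4 * (‖ψ x‖ : ℂ) ^ 2) • matN2 p) *
      Matrix.vecMulVec (psiVec ψ x) (psiVec ψ x)

/-- The matrix `M(x) = M̃(x) - N₀`. -/
def matM (x : ℝ) : Matrix (Fin 2) (Fin 2) ℂ := matMtilde p ψ x - matN0 p

lemma integrable_test_smul {n : Type} [Fintype n] (u : L2 n) {φ : ℝ → ℝ}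
    (hφ : Continuous φ) (hc : HasCompactSupport φ) : Integrable fun x => φ x • u x :=
  ((Lp.memLp u).locallyIntegrable (by norm_num)).integrable_smul_left_of_hasCompactSupport hφ hc

lemma HasWeakDeriv.add {n : Type} [Fintype n] {u v u' v' : L2 n}
    (h : HasWeakDeriv u v) (h' : HasWeakDeriv u' v') : HasWeakDeriv (u + u') (v + v') := by
  intro φ hφ hc
  have hd : Continuous (deriv φ) := hφ.continuous_deriv (by simp)
  have e1 : ∫ x, deriv φ x • (u + u') x = ∫ x, (deriv φ x • u x + deriv φ x • u' x) := by
    refine integral_congr_ae ?_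
    filter_upwards [Lp.coeFn_add u u'] with x hx
    rw [hx, Pi.add_apply, smul_add]
  have e2 : ∫ x, φ x • (v + v') x = ∫ x, (φ x • v x + φ x • v' x) := by
    refine integral_congr_ae ?_
    filter_upwards [Lp.coeFn_add v v'] with x hx
    rw [hx, Pi.add_apply, smul_add]
  rw [e1, e2, integral_add (integrable_test_smul u hd hc.deriv)
    (integrable_test_smul u' hd hc.deriv), integral_add
    (integrable_test_smul v hφ.continuous hc) (integrable_test_smul v' hφ.continuous hc),
    h φ hφ hc, h' φ hφ hc]
  abel

lemma HasWeakDeriv.smul {n : Type} [Fintype n] {u v : L2 n} (c : ℂ)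
    (h : HasWeakDeriv u v) : HasWeakDeriv (c • u) (c • v) := by
  intro φ hφ hc
  have e1 : ∫ x, deriv φ x • (c • u) x = ∫ x, c • (deriv φ x • u x) := by
    refine integral_congr_ae ?_
    filter_upwards [Lp.coeFn_smul c u] with x hx
    simp only [hx, Pi.smul_apply]
    exact smul_comm _ _ _
  have e2 : ∫ x, φ x • (c • v) x = ∫ x, c • (φ x • v x) := by
    refine integral_congr_ae ?_
    filter_upwards [Lp.coeFn_smul c v] with x hx
    simp only [hx, Pi.smul_apply]
    exact smul_comm _ _ _
  rw [e1, e2, integral_smul, integral_smul, h φ hφ hc, smul_neg]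

lemma HasWeakDeriv.zero {n : Type} [Fintype n] : HasWeakDeriv (0 : L2 n) 0 := by
  intro φ _ _
  have e (f : ℝ → ℝ) : ∫ x, f x • (0 : L2 n) x = 0 := by
    rw [← integral_zero ℝ (EuclideanSpace ℂ n)]
    refine integral_congr_ae ?_
    filter_upwards [Lp.coeFn_zero (EuclideanSpace ℂ n) 2 (volume : Measure ℝ)] with x hx
    rw [hx, Pi.zero_apply, smul_zero]
  rw [e, e, neg_zero]

lemma HasWeakDeriv.unique {n : Type} [Fintype n] {u v v' : L2 n}
    (h : HasWeakDeriv u v) (h' : HasWeakDeriv u v') : v = v' := by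
  refine Lp.ext (ae_eq_of_integral_contDiff_smul_eq
    ((Lp.memLp v).locallyIntegrable (by norm_num))
    ((Lp.memLp v').locallyIntegrable (by norm_num)) fun φ hφ hc => ?_)
  have := (h φ hφ hc).symm.trans (h' φ hφ hc)
  simpa using this

/-- The graph of the operator `ℒ = B ∂ₓ² + M̃(x)` in `L²(ℝ, ℂ²)`: the pairs `(q, f)` such that
`q` has weak derivatives `q'`, `q''` in `L²` (that is, `q ∈ H²`) and `f = B q'' + M̃ q`. -/
def graphL : Submodule ℂ (L2 (Fin 2) × L2 (Fin 2)) where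
  carrier := {z | ∃ q₁ q₂ : L2 (Fin 2), HasWeakDeriv z.1 q₁ ∧ HasWeakDeriv q₁ q₂ ∧
    ∀ᵐ x, z.2 x = act (matB p) (q₂ x) + act (matMtilde p ψ x) (z.1 x)}
  add_mem' := by
    rintro ⟨q, f⟩ ⟨r, g⟩ ⟨q₁, q₂, h1, h2, h3⟩ ⟨r₁, r₂, k1, k2, k3⟩
    refine ⟨q₁ + r₁, q₂ + r₂, h1.add k1, h2.add k2, ?_⟩
    filter_upwards [h3, k3, Lp.coeFn_add q r, Lp.coeFn_add f g, Lp.coeFn_add q₂ r₂]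
      with x a1 a2 a3 a4 a5
    simp only [Prod.mk_add_mk] at *
    rw [a3, a4, a5]
    simp only [Pi.add_apply, a1, a2, act, map_add]
    abel
  zero_mem' := by
    refine ⟨0, 0, .zero, .zero, ?_⟩
    filter_upwards [Lp.coeFn_zero (EuclideanSpace ℂ (Fin 2)) 2 (volume : Measure ℝ)] with x hx
    simp only [Prod.fst_zero, Prod.snd_zero, hx, Pi.zero_apply, act, map_zero, add_zero]
  smul_mem' := by
    rintro c ⟨q, f⟩ ⟨q₁, q₂, h1, h2, h3⟩
    refine ⟨c • q₁, c • q₂, h1.smul c, h2.smul c, ?_⟩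
    filter_upwards [h3, Lp.coeFn_smul c q, Lp.coeFn_smul c f, Lp.coeFn_smul c q₂]
      with x a1 a3 a4 a5
    simp only [Prod.smul_mk] at *
    rw [a3, a4, a5]
    simp only [Pi.smul_apply, a1, act, map_smul, smul_add]

/-- The unbounded operator `ℒ = B ∂ₓ² + M̃(x)` on `L²(ℝ, ℂ²)`; its domain is `H²(ℝ, ℂ²)` when
`M̃` is bounded and measurable. -/
def opL : L2 (Fin 2) →ₗ.[ℂ] L2 (Fin 2) := (graphL p ψ).toLinearPMap

/-- The set `graphL` is indeed the graph of `opL`. -/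
lemma opL_graph : (opL p ψ).graph = graphL p ψ := by
  refine Submodule.toLinearPMap_graph_eq _ ?_
  rintro ⟨q, f⟩ ⟨q₁, q₂, h1, h2, h3⟩ hq
  obtain rfl : q = 0 := hq
  obtain rfl := h1.unique .zero
  obtain rfl := h2.unique .zero
  refine Lp.ext ?_
  filter_upwards [h3, Lp.coeFn_zero (EuclideanSpace ℂ (Fin 2)) 2 (volume : Measure ℝ)] with x h hx
  simpa only [hx, Pi.zero_apply, act, map_zero, add_zero] using h

/-! ### The first order system -/

/-- The index type of the four coordinates of `ℂ⁴ = ℂ² × ℂ²`. -/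
abbrev I4 : Type := Fin 2 ⊕ Fin 2

/-- The matrix `A_∞(lam)`. -/
def matA : Matrix I4 I4 ℂ :=
  Matrix.fromBlocks 0 1 ((matB p)⁻¹ * (lam • (1 : Matrix (Fin 2) (Fin 2) ℂ) - matN0 p)) 0

/-- The matrix `R(x)`. -/
def matR (x : ℝ) : Matrix I4 I4 ℂ :=
  Matrix.fromBlocks 0 0 (-((matB p)⁻¹ * matM p ψ x)) 0

/-- The power `|M|^s = (Mᴴ M)^(s/2)` of the absolute value of a matrix, by the functional calculus
of Hermitian matrices. For `s < 0` the power is inverted on the range of `|M|` only: the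
eigenvalue `0` is sent to `0`. -/
def absPow (M : Matrix (Fin 2) (Fin 2) ℂ) (s : ℝ) : Matrix (Fin 2) (Fin 2) ℂ :=
  (Matrix.isHermitian_conjTranspose_mul_self M).cfc fun t => Real.sqrt t ^ s

/-- The factor `R_r(x)`, with the only non-zero block `|M|^(1/2)`. -/
def matRr (x : ℝ) : Matrix I4 I4 ℂ :=
  Matrix.fromBlocks (absPow (matM p ψ x) (1 / 2)) 0 0 0

/-- The factor `R_ℓ(x)`, with the only non-zero block `-B⁻¹ M |M|^(-1/2)`. If `M = V |M|` with `V`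
unitary, then `M |M|^(-1/2) = V |M|^(1/2)`, also where `M` is singular. -/
def matRl (x : ℝ) : Matrix I4 I4 ℂ :=
  Matrix.fromBlocks 0 0 (-((matB p)⁻¹ * (matM p ψ x * absPow (matM p ψ x) (-(1 / 2))))) 0

/-- The sum of the generalized eigenspaces of `f` for the eigenvalues in a set `s`. -/
def spectralSubspace {V : Type*} [AddCommGroup V] [Module ℂ V] (f : Module.End ℂ V) (s : Set ℂ) :
    Submodule ℂ V :=
  ⨆ z ∈ s, f.maxGenEigenspace z

lemma isCompl_spectralSubspace {V : Type*} [AddCommGroup V] [Module ℂ V]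
    [FiniteDimensional ℂ V] (f : Module.End ℂ V) (s : Set ℂ) :
    IsCompl (spectralSubspace f s) (spectralSubspace f sᶜ) := by
  constructor
  · exact f.independent_maxGenEigenspace.disjoint_biSup_biSup disjoint_compl_right
  · rw [codisjoint_iff, eq_top_iff, ← f.iSup_maxGenEigenspace_eq_top]
    refine iSup_le fun z => ?_
    by_cases hz : z ∈ s
    · exact (le_biSup (fun z => f.maxGenEigenspace z) hz).trans le_sup_left
    · exact (le_biSup (fun z => f.maxGenEigenspace z) (show z ∈ sᶜ from hz)).trans le_sup_right

/-- The matrix of the spectral projection onto the stable subspace of `A`, the sum of the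
generalized eigenspaces for the eigenvalues with negative real part, along the sum of the other
generalized eigenspaces. -/
def stableProj (A : Matrix I4 I4 ℂ) : Matrix I4 I4 ℂ :=
  LinearMap.toMatrix' ((spectralSubspace (Matrix.toLin' A) {z | z.re < 0}).projection _
    (isCompl_spectralSubspace (Matrix.toLin' A) {z | z.re < 0}))

/-- The Green's kernel of `-∂ₓ + A`. -/
def greenKernel (A : Matrix I4 I4 ℂ) (x : ℝ) : Matrix I4 I4 ℂ :=
  if 0 ≤ x then -(NormedSpace.exp ((x : ℂ) • A) * stableProj A)
  else NormedSpace.exp ((x : ℂ) • A) * (1 - stableProj A)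

/-- `K` is the symmetrized Birman-Schwinger operator `R_r 𝒢_A R_ℓ` on `L²(ℝ, ℂ⁴)`, where
`𝒢_A` is the Green's operator `w ↦ ∫ G_A(x - y) w(y) dy`, `A = A_∞(lam)`. -/
def IsBirmanSchwinger (K : L2 I4 →L[ℂ] L2 I4) : Prop :=
  ∀ u : L2 I4, ∀ᵐ x, K u x =
    act (matRr p ψ x) (∫ y, act (greenKernel (matA p lam) (x - y)) (act (matRl p ψ y) (u y)))

/-! ### The matrix of eigenvectors -/

/-- The number `a`. -/
def coefA : ℂ := (p.β * (lam - p.δ) - p.D * p.α / 2) / (matB p).det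

/-- The number `b`. -/
def coefB : ℂ := -(p.D / 2 * (lam - p.δ) + p.α * p.β) / (matB p).det

/-- The eigenvalue `σ₊`, the principal square root of `a + i b`. -/
def sigmaPlus : ℂ := (coefA p lam + Complex.I * coefB p lam) ^ (1 / 2 : ℂ)

/-- The eigenvalue `σ₋`, the principal square root of `a - i b`. -/
def sigmaMinus : ℂ := (coefA p lam - Complex.I * coefB p lam) ^ (1 / 2 : ℂ)

/-- The matrix of eigenvectors `P(lam)` of `A_∞(lam)`: the first matrix when there are two distinct
eigenvalues `±σ₊ = ±σ₋`, the second one when the four eigenvalues are distinct. -/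
def matP : Matrix I4 I4 ℂ :=
  let s := sigmaPlus p lam
  let t := sigmaMinus p lam
  if s = t then
    Matrix.fromBlocks
      !![0, 1; 1, 0] !![0, 1; 1, 0]
      !![0, -s; -s, 0] !![0, s; s, 0]
  else
    Matrix.fromBlocks
      !![Complex.I / t, -Complex.I / s; -1 / t, -1 / s]
      !![Complex.I / s, -Complex.I / t; 1 / s, 1 / t]
      !![-Complex.I, Complex.I; 1, 1] !![Complex.I, -Complex.I; 1, 1]

/-- `P` is an invertible matrix whose columns are eigenvectors of `A`. -/
def IsEigenvectorMatrix (A P : Matrix I4 I4 ℂ) : Prop :=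
  IsUnit P.det ∧ ∃ d : I4 → ℂ, A = P * Matrix.diagonal d * P⁻¹

/-- The condition number in the matrix 2-norm. -/
def condNumber (P : Matrix I4 I4 ℂ) : ℝ := ‖P‖ * ‖P⁻¹‖

end CGLE

end

open CGLE

/-! The proof has three ingredients.

First, the modified determinant is dominated by the Hilbert-Schmidt norm. For a matrix `A`, the
inequality `t ≤ exp (t - 1)` on the eigenvalues of `(1 + A)(1 + A)ᴴ` gives `|det (1 + A) exp (-tr
A)| ≤ exp (‖A‖² / 2)` in the Frobenius norm, in every dimension. Cauchy estimates for the entire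
function `z ↦ regDet (A + z E)` turn this into a dimension-free Lipschitz bound. Hence the
determinant extends continuously from finite rank operators, and `norm_det2_le` gives `|det₂ (I +
T)| ≤ exp (‖T‖²)`.

Second, the kernel `R_r(x) G(x - y) R_ℓ(y)` is square integrable. Diagonalizing `A_∞` by `P` gives
`‖G‖ ≤ cond P` (`norm_greenKernel_le`). Since `B` is a multiple of a unitary matrix, `‖R_r‖² ≤ |B|
‖R‖` and `‖R_ℓ‖² = ‖R‖ / |B|`, so `|B|` cancels. Bessel's inequality in `y` costs the dimension 4,
and each variable contributes `∫ exp (-a |x|) = 2 / a`. The result is `‖K‖² ≤ 16 C² cond² / a²`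
(`IsBirmanSchwinger.hsNormSq_le`).

Third, the explicit matrix `P` diagonalizes `A_∞` as soon as `σ₊` and `σ₋` are nonzero, that is,
`det (lam - N₀) ≠ 0`. If this fails, a kernel vector `e` of `N₀ - lam` gives a Weyl sequence `ε f(ε²
x) e`, which rules out closed range together with finite dimensional kernel and so puts `lam` in the
essential spectrum (`det_ne_zero_of_notMem_essentialSpectrum`). This is all that is needed from the
spectral hypothesis: the bound on `G` tolerates eigenvalues on the imaginary axis. -/

noncomputable section

namespace CGLE

/-! ### The regularized determinant of matrices -/

section MatrixDet

open scoped ComplexOrder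

variable {ι : Type*} [Fintype ι]

/-- The square of the Frobenius norm of a matrix. -/
def frobSq (A : Matrix ι ι ℂ) : ℝ := ∑ i, ∑ j, ‖A i j‖ ^ 2

lemma trace_mul_conjTranspose_re (A : Matrix ι ι ℂ) : (A * Aᴴ).trace.re = frobSq A := by
  simp only [Matrix.trace, Matrix.diag_apply, Matrix.mul_apply, Matrix.conjTranspose_apply,
    Complex.re_sum, frobSq]
  refine Finset.sum_congr rfl fun i _ => Finset.sum_congr rfl fun j _ => ?_
  rw [RCLike.star_def, Complex.mul_conj, Complex.normSq_eq_norm_sq, Complex.ofReal_re]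

lemma frobSq_add_smul_le (A E : Matrix ι ι ℂ) (z : ℂ) :
    frobSq (A + z • E) ≤ 2 * frobSq A + 2 * ‖z‖ ^ 2 * frobSq E := by
  simp only [frobSq, Finset.mul_sum, ← Finset.sum_add_distrib]
  refine Finset.sum_le_sum fun i _ => Finset.sum_le_sum fun j _ => ?_
  have h := norm_add_le (A i j) (z * E i j)
  rw [norm_mul] at h
  simp only [Matrix.add_apply, Matrix.smul_apply, smul_eq_mul]
  have h0 := norm_nonneg (A i j + z * E i j)
  nlinarith [sq_nonneg (‖A i j‖ - ‖z‖ * ‖E i j‖)]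

variable [DecidableEq ι]

/-- Apply `t ≤ exp (t - 1)` to each eigenvalue and multiply. -/
lemma det_le_exp_trace_sub_card {X : Matrix ι ι ℂ} (hX : X.PosSemidef) :
    ‖X.det‖ ≤ Real.exp (X.trace.re - Fintype.card ι) := by
  rw [hX.1.det_eq_prod_eigenvalues, hX.1.trace_eq_sum_eigenvalues, norm_prod]
  have h2 : ((∑ i, (hX.1.eigenvalues i : ℂ)).re - Fintype.card ι : ℝ)
      = ∑ i, (hX.1.eigenvalues i - 1) := by
    rw [Finset.sum_sub_distrib, Complex.re_sum]; simp
  refine le_trans ?_ (Real.exp_le_exp.2 h2.ge)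
  rw [Real.exp_sum]
  refine Finset.prod_le_prod (fun i _ => norm_nonneg _) fun i _ => ?_
  have h0 := hX.eigenvalues_nonneg i
  rw [RCLike.norm_ofReal, abs_of_nonneg h0]
  linarith [Real.add_one_le_exp (hX.1.eigenvalues i - 1)]

/-- The regularized determinant `det (1 + A) * exp (- tr A)` of a matrix. -/
def regDet (A : Matrix ι ι ℂ) : ℂ := (1 + A).det * Complex.exp (-A.trace)

/-- For `X = (1 + A)(1 + A)ᴴ` one has `tr X - n = 2 Re tr A + ‖A‖²`, and the factor `exp (-tr A)`
removes exactly the linear term. -/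
lemma norm_regDet_le (A : Matrix ι ι ℂ) : ‖regDet A‖ ≤ Real.exp (frobSq A / 2) := by
  have h1 := det_le_exp_trace_sub_card (Matrix.posSemidef_self_mul_conjTranspose (1 + A))
  have h2 : ‖((1 + A) * (1 + A)ᴴ).det‖ = ‖(1 + A).det‖ ^ 2 := by
    rw [Matrix.det_mul, Matrix.det_conjTranspose, norm_mul, norm_star, sq]
  have h3 : ((1 + A) * (1 + A)ᴴ).trace.re = Fintype.card ι + 2 * A.trace.re + frobSq A := by
    have : (1 + A) * (1 + A)ᴴ = 1 + A + Aᴴ + A * Aᴴ := by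
      rw [Matrix.conjTranspose_add, Matrix.conjTranspose_one]; noncomm_ring
    rw [this, Matrix.trace_add, Matrix.trace_add, Matrix.trace_add, Matrix.trace_one,
      Matrix.trace_conjTranspose, Complex.add_re, Complex.add_re, Complex.add_re,
      trace_mul_conjTranspose_re]
    simp
    ring
  rw [h2, h3] at h1
  refine (pow_le_pow_iff_left₀ (norm_nonneg _) (Real.exp_pos _).le two_ne_zero).1 ?_
  rw [regDet, norm_mul, mul_pow, Complex.norm_exp, ← Real.exp_nat_mul, ← Real.exp_nat_mul]
  refine (mul_le_mul_of_nonneg_right h1 (Real.exp_pos _).le).trans_eq ?_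
  rw [← Real.exp_add]
  congr 1
  simp
  ring

/-- A small `E` leaves the entire function `z ↦ regDet (A + z E)` bounded on a disc of radius about
`1 / r`. Cauchy's estimate then bounds its derivative by `r` times that bound, and the mean value
inequality from 0 to 1 concludes. Nothing depends on the size of the matrices. -/
lemma norm_regDet_add_sub_le (A E : Matrix ι ι ℂ) {r : ℝ} (hr : 0 < r) (hr1 : r ≤ 1)
    (hE : frobSq E ≤ r ^ 2) : ‖regDet (A + E) - regDet A‖ ≤ r * Real.exp (frobSq A + 4) := by
  set f : ℂ → ℂ := fun z => regDet (A + z • E) with hf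
  have hfd : Differentiable ℂ f := by
    simp only [hf, regDet, Matrix.trace, Matrix.det_apply]
    simp only [Matrix.add_apply, Matrix.smul_apply, Matrix.diag_apply]
    fun_prop
  -- The radius `1 + 1 / r` covers the circles of radius `1 / r` around points of the closed unit
  -- disc. There `‖z‖ r ≤ 2`, whence the 4.
  have hb : ∀ z : ℂ, ‖z‖ ≤ 1 + 1 / r → ‖f z‖ ≤ Real.exp (frobSq A + 4) := by
    intro z hz
    refine (norm_regDet_le _).trans (Real.exp_le_exp.2 ?_)
    have h1 := frobSq_add_smul_le A E z
    have h2 : ‖z‖ * r ≤ 2 := by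
      calc ‖z‖ * r ≤ (1 + 1 / r) * r := by gcongr
        _ = r + 1 := by field_simp
        _ ≤ 2 := by linarith
    have h3 : ‖z‖ ^ 2 * frobSq E ≤ 4 := by
      calc ‖z‖ ^ 2 * frobSq E ≤ ‖z‖ ^ 2 * r ^ 2 := by gcongr
        _ = (‖z‖ * r) ^ 2 := by ring
        _ ≤ 2 ^ 2 := by gcongr
        _ = 4 := by norm_num
    linarith
  have hd : ∀ z ∈ Metric.closedBall (0 : ℂ) 1, ‖deriv f z‖ ≤ r * Real.exp (frobSq A + 4) := by
    intro z hz
    rw [mem_closedBall_zero_iff] at hz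
    have := Complex.norm_deriv_le_of_forall_mem_sphere_norm_le (c := z) (one_div_pos.2 hr)
      hfd.diffContOnCl (C := Real.exp (frobSq A + 4)) fun w hw => hb w <| by
        rw [mem_sphere_iff_norm] at hw
        calc ‖w‖ = ‖z + (w - z)‖ := by ring_nf
          _ ≤ _ := (norm_add_le _ _).trans (by rw [hw]; linarith)
    refine this.trans_eq ?_
    field_simp
  have := (convex_closedBall (0 : ℂ) 1).norm_image_sub_le_of_norm_deriv_le
    (fun z _ => hfd z) hd (x := 0) (y := 1) (by simp) (by simp)
  simpa [hf] using this

end MatrixDet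

/-! ### Hilbert-Schmidt norms and finite rank operators -/

section HilbertSchmidt

variable {H : Type*} [NormedAddCommGroup H] [InnerProductSpace ℂ H]

lemma sum_enorm_sq_le_hsNormSq (T : H →L[ℂ] H) {ι : Type*} [Fintype ι] {v : ι → H}
    (hv : Orthonormal ℂ v) : ∑ i, ‖T (v i)‖ₑ ^ 2 ≤ hsNormSq T := by
  let e := Fintype.equivFin ι
  have h := le_iSup₂_of_le (f := fun (n : ℕ) (v : {v : Fin n → H // Orthonormal ℂ v}) =>
    ∑ i, ‖T (v.1 i)‖ₑ ^ 2) (Fintype.card ι) ⟨v ∘ e.symm, hv.comp _ e.symm.injective⟩ le_rfl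
  refine le_trans (le_of_eq ?_) h
  exact (Equiv.sum_comp e.symm fun i => ‖T (v i)‖ₑ ^ 2).symm

lemma enorm_add_sq_le {E : Type*} [SeminormedAddCommGroup E] (a b : E) :
    ‖a + b‖ₑ ^ 2 ≤ 2 * ‖a‖ₑ ^ 2 + 2 * ‖b‖ₑ ^ 2 := by
  have h : ‖a + b‖₊ ^ 2 ≤ 2 * ‖a‖₊ ^ 2 + 2 * ‖b‖₊ ^ 2 := by
    rw [← NNReal.coe_le_coe]
    push_cast
    have h := norm_add_le a b
    nlinarith [sq_nonneg (‖a‖ - ‖b‖), norm_nonneg (a + b)]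
  simp only [enorm]
  exact_mod_cast h

/-- A cheap substitute for the triangle inequality. Its factor 2 is what turns the exponent `r / 2`
for finite rank into `r` in `norm_det2_le`. -/
lemma hsNormSq_add_le (S T : H →L[ℂ] H) :
    hsNormSq (S + T) ≤ 2 * hsNormSq S + 2 * hsNormSq T := by
  refine iSup₂_le fun n v => ?_
  calc ∑ i, ‖(S + T) (v.1 i)‖ₑ ^ 2
      ≤ ∑ i, (2 * ‖S (v.1 i)‖ₑ ^ 2 + 2 * ‖T (v.1 i)‖ₑ ^ 2) :=
        Finset.sum_le_sum fun i _ => enorm_add_sq_le _ _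
    _ ≤ _ := by
        rw [Finset.sum_add_distrib, ← Finset.mul_sum, ← Finset.mul_sum]
        gcongr <;> exact sum_enorm_sq_le_hsNormSq _ v.2

lemma hsNormSq_neg (T : H →L[ℂ] H) : hsNormSq (-T) = hsNormSq T := by
  simp [hsNormSq]

lemma hsNormSq_sub_comm (S T : H →L[ℂ] H) : hsNormSq (S - T) = hsNormSq (T - S) := by
  rw [← hsNormSq_neg, neg_sub]

lemma sum_norm_sq_eq_trace {W : Type*} [NormedAddCommGroup W]
    [InnerProductSpace ℂ W] [CompleteSpace W] [CompleteSpace H] (T : W →L[ℂ] H)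
    {ι : Type*} [Fintype ι] (b : OrthonormalBasis ι ℂ W) :
    ((∑ i, ‖T (b i)‖ ^ 2 : ℝ) : ℂ) =
      LinearMap.trace ℂ W (T.adjoint ∘L T : W →L[ℂ] W).toLinearMap := by
  classical
  rw [LinearMap.trace_eq_sum_inner _ b, Complex.ofReal_sum]
  refine Finset.sum_congr rfl fun i _ => ?_
  simp [ContinuousLinearMap.adjoint_inner_right, inner_self_eq_norm_sq_to_K]

/-- Both sums are the trace of `T* T`, which does not see the basis. -/
lemma sum_enorm_sq_eq_of_orthonormalBasis {W : Type*} [NormedAddCommGroup W]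
    [InnerProductSpace ℂ W] [CompleteSpace W] [CompleteSpace H] (T : W →L[ℂ] H)
    {ι κ : Type*} [Fintype ι] [Fintype κ] (b : OrthonormalBasis ι ℂ W)
    (c : OrthonormalBasis κ ℂ W) : ∑ i, ‖T (b i)‖ₑ ^ 2 = ∑ j, ‖T (c j)‖ₑ ^ 2 := by
  have h : ∑ i, ‖T (b i)‖₊ ^ 2 = ∑ j, ‖T (c j)‖₊ ^ 2 := by
    rw [← NNReal.coe_inj]
    push_cast
    exact_mod_cast (sum_norm_sq_eq_trace T b).trans (sum_norm_sq_eq_trace T c).symm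
  simp only [enorm]
  exact_mod_cast h

/-- Composing with the projection onto the complement of an orthonormal family removes at least
the contribution of that family from the Hilbert-Schmidt norm. -/
lemma hsNormSq_comp_orthogonal_add_le [CompleteSpace H] (T : H →L[ℂ] H) {n : ℕ} {v : Fin n → H}
    (hv : Orthonormal ℂ v) (V : Submodule ℂ H) [V.HasOrthogonalProjection]
    (hV : V = Submodule.span ℂ (Set.range v)) :
    hsNormSq (T - T ∘L V.starProjection) + ∑ i, ‖T (v i)‖ₑ ^ 2 ≤ hsNormSq T := by
  classical
  have hvV : ∀ i, v i ∈ V := fun i => hV ▸ Submodule.subset_span ⟨i, rfl⟩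
  rw [hsNormSq, ENNReal.iSup_add]
  refine iSup_le fun m => ?_
  have : Nonempty {v : Fin n → H // Orthonormal ℂ v} := ⟨v, hv⟩
  -- In finite dimension there are no long orthonormal families; the inner supremum is then empty,
  -- equal to 0, and cannot be shifted by `ENNReal.iSup_add`.
  by_cases hne : Nonempty {v : Fin m → H // Orthonormal ℂ v}
  swap
  · rw [not_nonempty_iff] at hne
    rw [iSup_of_empty, bot_eq_zero, zero_add]
    exact sum_enorm_sq_le_hsNormSq T hv
  rw [ENNReal.iSup_add]
  refine iSup_le fun ⟨w, hw⟩ => ?_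
  dsimp only
  -- Inside this finite dimensional space the sum of squares may be computed in a basis extending
  -- `v` instead of one extending `w`.
  set W : Submodule ℂ H := Submodule.span ℂ (Set.range v ∪ Set.range w) with hW
  have : FiniteDimensional ℂ W :=
    FiniteDimensional.span_of_finite ℂ ((Set.finite_range v).union (Set.finite_range w))
  have hvW : ∀ i, v i ∈ W := fun i => Submodule.subset_span (Or.inl ⟨i, rfl⟩)
  have hwW : ∀ i, w i ∈ W := fun i => Submodule.subset_span (Or.inr ⟨i, rfl⟩)
  have : CompleteSpace W := FiniteDimensional.complete ℂ W
  -- orthonormal bases of `W` that extend the two families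
  have ext : ∀ {k : ℕ} {u : Fin k → H}, Orthonormal ℂ u → (hu : ∀ i, u i ∈ W) →
      ∃ (s : Finset W) (b : OrthonormalBasis s ℂ W), (Set.range fun i => (⟨u i, hu i⟩ : W)) ⊆ s ∧
        (⇑b = ((↑) : s → W)) := by
    intro k u hu huW
    have h1 : Orthonormal ℂ fun i => (⟨u i, huW i⟩ : W) := by
      rw [orthonormal_iff_ite] at hu ⊢
      exact hu
    exact h1.toSubtypeRange.exists_orthonormalBasis_extension
  obtain ⟨s, b, hsv, hb⟩ := ext hv hvW
  obtain ⟨t, c, htw, hc⟩ := ext hw hwW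
  have sum_eq : ∀ {k : ℕ} {u : Fin k → H}, Orthonormal ℂ u → (hu : ∀ i, u i ∈ W) →
      ∀ g : W → ENNReal, ∑ i, g ⟨u i, hu i⟩ =
        ∑ e ∈ Finset.univ.image fun i => (⟨u i, hu i⟩ : W), g e := by
    intro k u hu huW g
    rw [Finset.sum_image]
    intro i _ j _ hij
    exact hu.linearIndependent.injective (congrArg Subtype.val hij)
  set S : H →L[ℂ] H := T - T ∘L V.starProjection with hS
  have hsub : (Finset.univ.image fun i => (⟨v i, hvW i⟩ : W)) ⊆ s := by
    rw [← Finset.coe_subset, Finset.coe_image, Finset.coe_univ, Set.image_univ]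
    exact hsv
  have htub : (Finset.univ.image fun i => (⟨w i, hwW i⟩ : W)) ⊆ t := by
    rw [← Finset.coe_subset, Finset.coe_image, Finset.coe_univ, Set.image_univ]
    exact htw
  have hSv : ∀ i, S (v i) = 0 := fun i => by
    simp [hS, Submodule.starProjection_eq_self_iff.2 (hvV i)]
  -- The remaining basis vectors are orthogonal to `V`, so the projection kills them.
  have hSe : ∀ e ∈ s \ Finset.univ.image (fun i => (⟨v i, hvW i⟩ : W)), S e = T e := by
    intro e he
    rw [Finset.mem_sdiff, Finset.mem_image] at he
    have : V.starProjection (e : H) = 0 := by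
      rw [Submodule.starProjection_apply_eq_zero_iff, hV, Submodule.mem_orthogonal]
      intro x hx
      induction hx using Submodule.span_induction with
      | mem x h =>
        obtain ⟨i, rfl⟩ := h
        have h1 : (⟨v i, hvW i⟩ : W) ∈ s := hsub (Finset.mem_image_of_mem _ (Finset.mem_univ i))
        have h2 := b.orthonormal.2 (i := ⟨_, h1⟩) (j := ⟨e, he.1⟩) fun h =>
          he.2 ⟨i, Finset.mem_univ i, congrArg Subtype.val h⟩
        rw [hb] at h2
        exact h2
      | zero => simp
      | add x y _ _ hx hy => rw [inner_add_left, hx, hy, add_zero]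
      | smul a x _ hx => rw [inner_smul_left, hx, mul_zero]
    simp [hS, this]
  have e1 : ∑ i, ‖S (w i)‖ₑ ^ 2 ≤ ∑ e ∈ s, ‖S e‖ₑ ^ 2 := by
    have h := sum_enorm_sq_eq_of_orthonormalBasis (S ∘L W.subtypeL) c b
    simp only [hb, hc, ContinuousLinearMap.comp_apply, Submodule.subtypeL_apply] at h
    rw [Finset.sum_coe_sort t fun e : W => ‖S e‖ₑ ^ 2,
      Finset.sum_coe_sort s fun e : W => ‖S e‖ₑ ^ 2] at h
    rw [← h, sum_eq hw hwW fun e => ‖S e‖ₑ ^ 2]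
    exact Finset.sum_le_sum_of_subset htub
  have e2 : ∑ e ∈ s, ‖S e‖ₑ ^ 2 =
      ∑ e ∈ s \ Finset.univ.image (fun i => (⟨v i, hvW i⟩ : W)), ‖T e‖ₑ ^ 2 := by
    rw [← Finset.sum_sdiff hsub, ← sum_eq hv hvW fun e => ‖S e‖ₑ ^ 2]
    simp only [hSv, enorm_zero, ne_eq, OfNat.ofNat_ne_zero, not_false_eq_true, zero_pow,
      Finset.sum_const_zero, add_zero]
    exact Finset.sum_congr rfl fun e he => by rw [hSe e he]
  calc ∑ i, ‖S (w i)‖ₑ ^ 2 + ∑ i, ‖T (v i)‖ₑ ^ 2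
      ≤ ∑ e ∈ s \ Finset.univ.image (fun i => (⟨v i, hvW i⟩ : W)), ‖T e‖ₑ ^ 2 +
        ∑ i, ‖T (v i)‖ₑ ^ 2 := by gcongr; exact e1.trans_eq e2
    _ = ∑ e ∈ s, ‖T e‖ₑ ^ 2 := by
        rw [sum_eq hv hvW fun e => ‖T e‖ₑ ^ 2, Finset.sum_sdiff hsub]
    _ = ∑ e : s, ‖T (b e : H)‖ₑ ^ 2 := by
        rw [hb, Finset.sum_coe_sort s fun e : W => ‖T e‖ₑ ^ 2]
    _ ≤ hsNormSq T := sum_enorm_sq_le_hsNormSq T (b.orthonormal.comp_linearIsometry W.subtypeₗᵢ)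

/-- Hilbert-Schmidt operators are limits of finite rank operators in the Hilbert-Schmidt norm. -/
lemma IsHilbertSchmidt.exists_isFiniteRank [CompleteSpace H] {T : H →L[ℂ] H}
    (hT : IsHilbertSchmidt T) {ε : ENNReal} (hε : ε ≠ 0) :
    ∃ F : H →L[ℂ] H, IsFiniteRank F ∧ hsNormSq (F - T) ≤ ε := by
  have hne : hsNormSq T ≠ ⊤ := hT.ne
  obtain ⟨n, v, hv⟩ : ∃ (n : ℕ) (v : {v : Fin n → H // Orthonormal ℂ v}),
      hsNormSq T ≤ ∑ i, ‖T (v.1 i)‖ₑ ^ 2 + ε := by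
    by_contra! h
    have h1 : hsNormSq T + ε ≤ hsNormSq T + 0 := by
      rw [add_zero]
      conv_lhs => rw [hsNormSq, ENNReal.iSup_add]
      refine iSup_le fun n => ?_
      by_cases hn : Nonempty {v : Fin n → H // Orthonormal ℂ v}
      · rw [ENNReal.iSup_add]
        exact iSup_le fun v => (h n v).le
      · rw [not_nonempty_iff] at hn
        rw [iSup_of_empty, bot_eq_zero, zero_add]
        exact le_add_self.trans (h 0 ⟨![], by simp⟩).le
    rw [ENNReal.add_le_add_iff_left hne] at h1
    exact hε (le_antisymm h1 bot_le)
  -- The family `v` captures the Hilbert-Schmidt norm up to `ε`, so cutting `T` off to its span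
  -- leaves a remainder of at most `ε`.
  let V := Submodule.span ℂ (Set.range v.1)
  have : FiniteDimensional ℂ V := FiniteDimensional.span_of_finite ℂ (Set.finite_range v.1)
  refine ⟨T ∘L V.starProjection, ?_, ?_⟩
  · have hle : LinearMap.range ((T ∘L V.starProjection : H →L[ℂ] H) : H →ₗ[ℂ] H) ≤
        V.map (T : H →ₗ[ℂ] H) := by
      rintro _ ⟨x, rfl⟩
      exact ⟨V.starProjection x, Submodule.starProjection_apply_mem _ _, rfl⟩
    exact Submodule.finiteDimensional_of_le hle
  · have h := (hsNormSq_comp_orthogonal_add_le T v.2 V rfl).trans hv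
    rw [add_comm] at h
    rw [hsNormSq_sub_comm]
    refine (ENNReal.add_le_add_iff_left ?_).1 h
    exact ne_top_of_le_ne_top hne (sum_enorm_sq_le_hsNormSq T v.2)

/-- The matrix of the compression of an operator to a finite dimensional subspace. -/
def compressionMatrix {ι : Type*} {V : Submodule ℂ H} (F : H →L[ℂ] H) (b : ι → V) :
    Matrix ι ι ℂ :=
  Matrix.of fun i j => inner ℂ (b i : H) (F (b j))

lemma compressionMatrix_sub {ι : Type*} {V : Submodule ℂ H} (F G : H →L[ℂ] H) (b : ι → V) :
    compressionMatrix (F - G) b = compressionMatrix F b - compressionMatrix G b := by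
  ext i j
  simp [compressionMatrix]

/-- Bessel's inequality in each column. -/
lemma frobSq_compressionMatrix_le {ι : Type*} [Fintype ι] {V : Submodule ℂ H}
    (F : H →L[ℂ] H) (b : OrthonormalBasis ι ℂ V) {r : ℝ}
    (h : hsNormSq F ≤ ENNReal.ofReal r) (hr : 0 ≤ r) : frobSq (compressionMatrix F b) ≤ r := by
  have hb : Orthonormal ℂ fun i => (b i : H) := b.orthonormal.comp_linearIsometry V.subtypeₗᵢ
  have h1 : ∑ j, ‖F (b j)‖ ^ 2 ≤ r := by
    have := (sum_enorm_sq_le_hsNormSq F hb).trans h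
    rw [← ENNReal.ofReal_le_ofReal_iff hr, ENNReal.ofReal_sum_of_nonneg (by intros; positivity)]
    refine le_trans (le_of_eq ?_) this
    refine Finset.sum_congr rfl fun i _ => ?_
    rw [ENNReal.ofReal_pow (norm_nonneg _), ofReal_norm]
  refine le_trans ?_ h1
  rw [frobSq, Finset.sum_comm]
  exact Finset.sum_le_sum fun j _ => hb.sum_inner_products_le (F (b j)) (s := Finset.univ)

/-- On its range `F` is `f ∘ g`, and on `V` it is `g ∘ f`, with `g` the inclusion. Sylvester's
identity and cyclicity of the trace equate the two. The freedom in `V` lets two operators be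
compared as matrices of one size. -/
lemma det2FiniteRank_eq_regDet {F : H →L[ℂ] H} {V : Submodule ℂ H} [FiniteDimensional ℂ V]
    (hV : LinearMap.range (F : H →ₗ[ℂ] H) ≤ V) {ι : Type*} [Fintype ι] [DecidableEq ι]
    (b : OrthonormalBasis ι ℂ V) : det2FiniteRank F = regDet (compressionMatrix F b) := by
  classical
  set R := LinearMap.range (F : H →ₗ[ℂ] H) with hR
  have : FiniteDimensional ℂ R := Submodule.finiteDimensional_of_le hV
  let c := Module.finBasis ℂ R
  let f : V →ₗ[ℂ] R := (F : H →ₗ[ℂ] H).rangeRestrict ∘ₗ V.subtype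
  let g : R →ₗ[ℂ] V := Submodule.inclusion hV
  have h1 : restrictRange F = f ∘ₗ g := by
    ext x
    rfl
  have h2 : compressionMatrix F b =
      LinearMap.toMatrix c b.toBasis g * LinearMap.toMatrix b.toBasis c f := by
    rw [← LinearMap.toMatrix_comp]
    ext i j
    rw [LinearMap.toMatrix_apply]
    simp only [OrthonormalBasis.coe_toBasis_repr_apply, OrthonormalBasis.repr_apply_apply,
      OrthonormalBasis.coe_toBasis]
    rfl
  rw [det2FiniteRank, regDet, h1, ← LinearMap.det_toMatrix c, LinearMap.trace_eq_matrix_trace ℂ c,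
    map_add, LinearMap.toMatrix_one, LinearMap.toMatrix_comp c b.toBasis c, h2,
    Matrix.det_one_add_mul_comm, Matrix.trace_mul_comm]

lemma norm_det2FiniteRank_le {F : H →L[ℂ] H} (hF : IsFiniteRank F) {r : ℝ} (hr : 0 ≤ r)
    (h : hsNormSq F ≤ ENNReal.ofReal r) : ‖det2FiniteRank F‖ ≤ Real.exp (r / 2) := by
  have : FiniteDimensional ℂ (LinearMap.range (F : H →ₗ[ℂ] H)) := hF
  rw [det2FiniteRank_eq_regDet le_rfl (stdOrthonormalBasis ℂ _)]
  refine (norm_regDet_le _).trans (Real.exp_le_exp.2 ?_)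
  gcongr
  exact frobSq_compressionMatrix_le F _ h hr

/-- Compress both operators to the sum of their ranges; the matrix estimate is independent of its
dimension. -/
lemma norm_det2FiniteRank_sub_le {F G : H →L[ℂ] H} (hF : IsFiniteRank F) (hG : IsFiniteRank G)
    {r s : ℝ} (hr : 0 ≤ r) (h : hsNormSq F ≤ ENNReal.ofReal r) (hs : 0 < s) (hs1 : s ≤ 1)
    (hFG : hsNormSq (G - F) ≤ ENNReal.ofReal (s ^ 2)) :
    ‖det2FiniteRank G - det2FiniteRank F‖ ≤ s * Real.exp (r + 4) := by
  have : FiniteDimensional ℂ (LinearMap.range (F : H →ₗ[ℂ] H)) := hF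
  have : FiniteDimensional ℂ (LinearMap.range (G : H →ₗ[ℂ] H)) := hG
  let V := LinearMap.range (F : H →ₗ[ℂ] H) ⊔ LinearMap.range (G : H →ₗ[ℂ] H)
  let b := stdOrthonormalBasis ℂ V
  rw [det2FiniteRank_eq_regDet (V := V) le_sup_left b,
    det2FiniteRank_eq_regDet (V := V) le_sup_right b]
  have h1 := norm_regDet_add_sub_le (compressionMatrix F b) (compressionMatrix (G - F) b) hs hs1
    (frobSq_compressionMatrix_le _ b hFG (by positivity))
  rw [compressionMatrix_sub, add_sub_cancel] at h1
  refine h1.trans ?_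
  gcongr
  exact frobSq_compressionMatrix_le F b h hr

/-- The modified determinant of a Hilbert-Schmidt operator is bounded by the exponential of the
square of its Hilbert-Schmidt norm. -/
lemma norm_det2_le [CompleteSpace H] {T : H →L[ℂ] H}
    {r : ℝ} (hr : 0 ≤ r) (h : hsNormSq T ≤ ENNReal.ofReal r) :
    ‖det2 T‖ ≤ Real.exp r := by
  have hT : IsHilbertSchmidt T := h.trans_lt ENNReal.ofReal_lt_top
  set 𝓕 := comap (fun F : H →L[ℂ] H => hsNormSq (F - T)) (𝓝 0) ⊓ 𝓟 {F | IsFiniteRank F} with h𝓕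
  have hev : ∀ s : ℝ, 0 < s → ∀ᶠ F in 𝓕, IsFiniteRank F ∧ hsNormSq (F - T) ≤ ENNReal.ofReal s := by
    intro s hs
    rw [h𝓕, eventually_inf_principal]
    have : ∀ᶠ y in 𝓝 (0 : ENNReal), y ≤ ENNReal.ofReal s :=
      Iic_mem_nhds (ENNReal.ofReal_pos.2 hs)
    filter_upwards [this.comap _] with F hF hF' using ⟨hF', hF⟩
  have hne : 𝓕.NeBot := by
    rw [h𝓕, inf_principal_neBot_iff]
    intro U hU
    obtain ⟨t, ht, htU⟩ := mem_comap.1 hU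
    obtain ⟨ε, hε, hεt⟩ := (ENNReal.nhds_zero_basis_Iic.mem_iff).1 ht
    obtain ⟨F, hF, hFT⟩ := hT.exists_isFiniteRank hε.ne'
    exact ⟨F, htU (hεt hFT), hF⟩
  have hbd : ∀ s : ℝ, 0 ≤ s → ∀ F : H →L[ℂ] H, hsNormSq (F - T) ≤ ENNReal.ofReal s →
      hsNormSq F ≤ ENNReal.ofReal (2 * r + 2 * s) := by
    intro s hs F hF
    calc hsNormSq F = hsNormSq (T + (F - T)) := by rw [add_sub_cancel]
      _ ≤ 2 * hsNormSq T + 2 * hsNormSq (F - T) := hsNormSq_add_le _ _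
      _ ≤ 2 * ENNReal.ofReal r + 2 * ENNReal.ofReal s := by gcongr
      _ = ENNReal.ofReal (2 * r + 2 * s) := by
        rw [ENNReal.ofReal_add (by positivity) (by positivity), ENNReal.ofReal_mul zero_le_two,
          ENNReal.ofReal_mul zero_le_two, ENNReal.ofReal_ofNat]
  -- `limUnder` is meaningful only once the limit exists, so convergence has to be proved first.
  have hc : Cauchy (map det2FiniteRank 𝓕) := by
    rw [Metric.cauchy_iff]
    refine ⟨hne.map _, fun ε hε => ?_⟩
    set s := min 1 (ε / (2 * Real.exp (2 * r + 2 * 1 + 4))) with hs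
    have hs0 : 0 < s := by positivity
    -- Two operators within `s² / 4` of `T` are within `2 (s² / 4) + 2 (s² / 4) = s²` of each other.
    have hs1 : s ≤ 1 := min_le_left _ _
    refine ⟨_, image_mem_map (hev (s ^ 2 / 4) (by positivity)), ?_⟩
    rintro _ ⟨F, ⟨hF, hFT⟩, rfl⟩ _ ⟨G, ⟨hG, hGT⟩, rfl⟩
    have hF1 := hbd 1 zero_le_one G (hGT.trans (ENNReal.ofReal_le_ofReal (by nlinarith)))
    have hFG : hsNormSq (F - G) ≤ ENNReal.ofReal (s ^ 2) := by
      calc hsNormSq (F - G) = hsNormSq ((F - T) + (T - G)) := by rw [sub_add_sub_cancel]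
        _ ≤ 2 * hsNormSq (F - T) + 2 * hsNormSq (T - G) := hsNormSq_add_le _ _
        _ ≤ 2 * ENNReal.ofReal (s ^ 2 / 4) + 2 * ENNReal.ofReal (s ^ 2 / 4) := by
          rw [hsNormSq_sub_comm T G]; gcongr
        _ = ENNReal.ofReal (s ^ 2) := by
          rw [← ENNReal.ofReal_ofNat, ← ENNReal.ofReal_mul zero_le_two,
            ← ENNReal.ofReal_add (by positivity) (by positivity)]
          congr 1; ring
    rw [dist_eq_norm]
    refine (norm_det2FiniteRank_sub_le hG hF (by positivity) hF1 hs0 hs1 hFG).trans_lt ?_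
    calc s * Real.exp (2 * r + 2 * 1 + 4)
        ≤ ε / (2 * Real.exp (2 * r + 2 * 1 + 4)) * Real.exp (2 * r + 2 * 1 + 4) := by
          gcongr; exact min_le_right _ _
      _ = ε / 2 := by field_simp
      _ < ε := by linarith
  obtain ⟨z, hz⟩ := CompleteSpace.complete hc
  have hlim : Tendsto det2FiniteRank 𝓕 (𝓝 (det2 T)) := tendsto_nhds_limUnder ⟨z, hz⟩
  -- Nearby finite rank operators have squared norm at most `2 r + 2 s`, half of which is the
  -- exponent; afterwards `s → 0`.
  have hle : ∀ s : ℝ, 0 < s → ‖det2 T‖ ≤ Real.exp (r + s) := by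
    intro s hs
    refine le_of_tendsto hlim.norm ?_
    filter_upwards [hev s hs] with F hF
    refine (norm_det2FiniteRank_le hF.1 (by positivity) (hbd s hs.le F hF.2)).trans ?_
    exact Real.exp_le_exp.2 (by linarith)
  have hcont : Tendsto (fun s : ℝ => Real.exp (r + s)) (𝓝[>] 0) (𝓝 (Real.exp r)) := by
    have : Continuous fun s : ℝ => Real.exp (r + s) := by fun_prop
    simpa using (this.tendsto 0).mono_left nhdsWithin_le_nhds
  exact ge_of_tendsto hcont (eventually_nhdsWithin_of_forall hle)

end HilbertSchmidt

end CGLE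

end
noncomputable section

namespace CGLE

/-! ### Algebra of the coefficient matrices -/

section Coefficients

variable {p : Params} {ψ : ℝ → ℂ} {lam : ℂ}

lemma det_rot (a b : ℝ) : (rot a b).det = (a : ℂ) ^ 2 + (b : ℂ) ^ 2 := by
  simp [rot, Matrix.det_fin_two]; ring

lemma det_matB : (matB p).det = ((p.β ^ 2 + (p.D / 2) ^ 2 : ℝ) : ℂ) := by
  rw [matB, det_rot]; push_cast; ring

lemma sq_add_sq_pos_of_ne (hp : (p.D, p.β) ≠ (0, 0)) : 0 < p.β ^ 2 + (p.D / 2) ^ 2 := by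
  by_contra! h
  refine hp (Prod.ext ?_ ?_) <;> simp only <;>
    nlinarith [sq_nonneg p.β, sq_nonneg p.D, sq_nonneg (p.D / 2)]

lemma det_matB_ne_zero (hp : (p.D, p.β) ≠ (0, 0)) : (matB p).det ≠ 0 := by
  rw [det_matB, Complex.ofReal_ne_zero]
  exact (sq_add_sq_pos_of_ne hp).ne'

lemma conjTranspose_rot_mul_self (a b : ℝ) :
    (rot a b)ᴴ * rot a b = ((a ^ 2 + b ^ 2 : ℝ) : ℂ) • 1 := by
  ext i j
  fin_cases i <;> fin_cases j <;>
    simp [rot, Matrix.mul_apply, Fin.sum_univ_two, Matrix.conjTranspose_apply] <;> ring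

/-- `B` is a positive multiple of a unitary matrix, so it scales norms exactly and no condition
number of `B` enters the final bound. -/
lemma norm_matB_mul (X : Matrix (Fin 2) (Fin 2) ℂ) :
    ‖matB p * X‖ = √(p.β ^ 2 + (p.D / 2) ^ 2) * ‖X‖ := by
  have h : ‖matB p * X‖ * ‖matB p * X‖ = (p.β ^ 2 + (p.D / 2) ^ 2) * (‖X‖ * ‖X‖) := by
    rw [← Matrix.l2_opNorm_conjTranspose_mul_self, Matrix.conjTranspose_mul, Matrix.mul_assoc,
      ← Matrix.mul_assoc (matB p)ᴴ, matB, conjTranspose_rot_mul_self, Matrix.smul_mul, Matrix.one_mul,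
      Matrix.mul_smul, norm_smul, Matrix.l2_opNorm_conjTranspose_mul_self, Complex.norm_real,
      Real.norm_of_nonneg (by positivity)]
  rw [← Real.sqrt_mul_self (norm_nonneg (matB p * X)), h, Real.sqrt_mul (by positivity),
    Real.sqrt_mul_self (norm_nonneg X)]

/-- The block `B⁻¹ (lam - N₀)` of `A_∞(lam)` is the complex rotation matrix with entries
`a` and `b`. -/
lemma matB_inv_mul (hp : (p.D, p.β) ≠ (0, 0)) :
    (matB p)⁻¹ * (lam • (1 : Matrix (Fin 2) (Fin 2) ℂ) - matN0 p) =
      !![coefA p lam, -coefB p lam; coefB p lam, coefA p lam] := by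
  have h := det_matB_ne_zero hp
  rw [Matrix.inv_def, Ring.inverse_eq_inv', matB, rot, Matrix.adjugate_fin_two_of, ← rot, ← matB]
  ext i j
  fin_cases i <;> fin_cases j <;>
    simp [matN0, rot, coefA, coefB, Matrix.mul_apply, Fin.sum_univ_two] <;> field_simp <;> ring

lemma coefA_sq_add_coefB_sq (hp : (p.D, p.β) ≠ (0, 0)) :
    coefA p lam ^ 2 + coefB p lam ^ 2 =
      (lam • (1 : Matrix (Fin 2) (Fin 2) ℂ) - matN0 p).det / (matB p).det := by
  have h := congrArg Matrix.det (matB_inv_mul (lam := lam) hp)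
  rw [Matrix.det_mul, Matrix.det_nonsing_inv, Ring.inverse_eq_inv', Matrix.det_fin_two_of] at h
  rw [div_eq_inv_mul, h]
  ring

lemma cpow_half_sq (z : ℂ) : (z ^ (1 / 2 : ℂ)) ^ 2 = z := by
  rw [one_div]
  exact_mod_cast Complex.cpow_nat_inv_pow z two_ne_zero

lemma sigmaPlus_sq : sigmaPlus p lam ^ 2 = coefA p lam + Complex.I * coefB p lam :=
  cpow_half_sq _

lemma sigmaMinus_sq : sigmaMinus p lam ^ 2 = coefA p lam - Complex.I * coefB p lam :=
  cpow_half_sq _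

/-- `(σ₊ σ₋)² = a² + b² = det (lam - N₀) / det B`. -/
lemma sigma_ne_zero (hp : (p.D, p.β) ≠ (0, 0))
    (h : (lam • (1 : Matrix (Fin 2) (Fin 2) ℂ) - matN0 p).det ≠ 0) :
    sigmaPlus p lam ≠ 0 ∧ sigmaMinus p lam ≠ 0 := by
  have h1 : sigmaPlus p lam ^ 2 * sigmaMinus p lam ^ 2 ≠ 0 := by
    have : sigmaPlus p lam ^ 2 * sigmaMinus p lam ^ 2 = coefA p lam ^ 2 + coefB p lam ^ 2 := by
      rw [sigmaPlus_sq, sigmaMinus_sq]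
      linear_combination -(coefB p lam) ^ 2 * Complex.I_sq
    rw [this, coefA_sq_add_coefB_sq hp]
    exact div_ne_zero h (det_matB_ne_zero hp)
  constructor
  · rintro h0
    simp [h0] at h1
  · rintro h0
    simp [h0] at h1

lemma isEigenvectorMatrix_of_mul_eq {A P Q : Matrix I4 I4 ℂ} {d : I4 → ℂ} (hPQ : P * Q = 1)
    (h : A * P = P * Matrix.diagonal d) : IsEigenvectorMatrix A P := by
  have hu : IsUnit P.det := Matrix.isUnit_det_of_right_inverse hPQ
  refine ⟨hu, d, ?_⟩
  rw [← h, Matrix.mul_nonsing_inv_cancel_right _ _ hu]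

/-- The block with entries `a`, `b` has eigenvectors `(±i, 1)` with eigenvalues `a ± i b`, so `A_∞`
has eigenvalues `±σ₊`, `±σ₋`. When `σ₊ = σ₋` the block is scalar. Invertibility is checked with an
explicit inverse `Q`. -/
lemma isEigenvectorMatrix_matP (hp : (p.D, p.β) ≠ (0, 0))
    (h : (lam • (1 : Matrix (Fin 2) (Fin 2) ℂ) - matN0 p).det ≠ 0) :
    IsEigenvectorMatrix (matA p lam) (matP p lam) := by
  obtain ⟨hs, ht⟩ := sigma_ne_zero hp h
  have hs2 := sigmaPlus_sq (p := p) (lam := lam)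
  have ht2 := sigmaMinus_sq (p := p) (lam := lam)
  rw [matA, matB_inv_mul hp, matP]
  set s := sigmaPlus p lam
  set t := sigmaMinus p lam
  set a := coefA p lam
  set b := coefB p lam
  have hI := Complex.I_sq
  split_ifs with hst
  · have hb : b = 0 := by
      rw [← hst, hs2] at ht2
      have : Complex.I * b = 0 := by linear_combination ht2 / 2
      simpa using this
    have ha : a = s ^ 2 := by rw [hs2, hb]; ring
    refine isEigenvectorMatrix_of_mul_eq (d := Sum.elim ![-s, -s] ![s, s])
      (Q := Matrix.fromBlocks !![0, 1 / 2; 1 / 2, 0] !![0, -1 / (2 * s); -1 / (2 * s), 0]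
        !![0, 1 / 2; 1 / 2, 0] !![0, 1 / (2 * s); 1 / (2 * s), 0]) ?_ ?_
    · rw [Matrix.fromBlocks_multiply, ← Matrix.fromBlocks_one]
      congr 1 <;> ext i j <;> fin_cases i <;> fin_cases j <;>
        simp <;> field_simp <;> ring
    · rw [← Matrix.fromBlocks_diagonal, Matrix.fromBlocks_multiply, Matrix.fromBlocks_multiply]
      congr 1 <;> ext i j <;> fin_cases i <;> fin_cases j <;>
        simp [hb, ha, Matrix.vecMul_diagonal] <;> ring
  · have ha : a = (s ^ 2 + t ^ 2) / 2 := by rw [hs2, ht2]; ring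
    have hb : b = -Complex.I * (s ^ 2 - t ^ 2) / 2 := by
      rw [hs2, ht2]
      linear_combination b * hI
    refine isEigenvectorMatrix_of_mul_eq (d := Sum.elim ![-t, -s] ![s, t])
      (Q := (1 / 4 : ℂ) • Matrix.fromBlocks
        !![-Complex.I * t, -t; Complex.I * s, -s]
        !![Complex.I, 1; -Complex.I, 1]
        !![-Complex.I * s, s; Complex.I * t, t]
        !![-Complex.I, 1; Complex.I, 1]) ?_ ?_
    · rw [Matrix.mul_smul, Matrix.fromBlocks_multiply, Matrix.fromBlocks_smul,
        ← Matrix.fromBlocks_one]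
      congr 1 <;> ext i j <;> fin_cases i <;> fin_cases j <;>
        simp <;> field_simp <;> ring_nf <;>
        simp only [hI] <;> ring
    · rw [← Matrix.fromBlocks_diagonal, Matrix.fromBlocks_multiply, Matrix.fromBlocks_multiply]
      congr 1 <;> ext i j <;> fin_cases i <;> fin_cases j <;>
        simp [Matrix.vecMul_diagonal, ha, hb] <;> field_simp <;> ring_nf <;>
        (try simp only [hI]) <;> (try ring)

end Coefficients

/-! ### The Green's kernel -/

section Green

variable {A P : Matrix I4 I4 ℂ} {d : I4 → ℂ}

lemma mulVec_single_eq_smul (hP : IsUnit P.det) (hA : A = P * Matrix.diagonal d * P⁻¹) (j : I4) :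
    Matrix.toLin' A (P *ᵥ Pi.single j 1) = d j • (P *ᵥ Pi.single j 1) := by
  rw [Matrix.toLin'_apply, hA, Matrix.mulVec_mulVec, Matrix.nonsing_inv_mul_cancel_right _ _ hP,
    ← Matrix.mulVec_mulVec, Matrix.diagonal_mulVec_single, mul_one, ← Matrix.mulVec_smul,
    ← Pi.single_smul', smul_eq_mul, mul_one]

lemma mulVec_single_mem_spectralSubspace (hP : IsUnit P.det)
    (hA : A = P * Matrix.diagonal d * P⁻¹) {j : I4} {s : Set ℂ} (hj : d j ∈ s) :
    P *ᵥ Pi.single j 1 ∈ spectralSubspace (Matrix.toLin' A) s := by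
  refine Submodule.mem_iSup_of_mem (d j) (Submodule.mem_iSup_of_mem hj ?_)
  refine Module.End.mem_maxGenEigenspace _ _ _ |>.2 ⟨1, ?_⟩
  rw [pow_one, LinearMap.sub_apply, mulVec_single_eq_smul hP hA]
  simp

/-- Compare on the columns of `P`: each is an eigenvector lying in one of the two complementary
spectral subspaces, hence fixed or killed. -/
lemma stableProj_eq (hP : IsUnit P.det) (hA : A = P * Matrix.diagonal d * P⁻¹) :
    stableProj A = P * Matrix.diagonal (fun j => if (d j).re < 0 then 1 else 0) * P⁻¹ := by
  have h : stableProj A * P = P * Matrix.diagonal (fun j => if (d j).re < 0 then 1 else 0) := by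
    refine Matrix.toLin'.injective ?_
    refine (Pi.basisFun ℂ I4).ext fun j => ?_
    rw [Pi.basisFun_apply, Matrix.toLin'_apply, Matrix.toLin'_apply, ← Matrix.mulVec_mulVec,
      ← Matrix.mulVec_mulVec, Matrix.diagonal_mulVec_single, mul_one, stableProj,
      LinearMap.toMatrix'_mulVec]
    split_ifs with hj
    · exact Submodule.projection_apply_of_mem_left _
        (mulVec_single_mem_spectralSubspace hP hA hj)
    · rw [Pi.single_zero, Matrix.mulVec_zero]
      exact Submodule.projection_apply_of_mem_right _
        (mulVec_single_mem_spectralSubspace hP hA hj)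
  rw [← h, Matrix.mul_nonsing_inv_cancel_right _ _ hP]

/-- The eigenvalue of the Green's kernel on the `j`-th eigenvector. -/
def greenCoef (d : I4 → ℂ) (x : ℝ) (j : I4) : ℂ :=
  if 0 ≤ x then (if (d j).re < 0 then -Complex.exp (x * d j) else 0)
  else (if (d j).re < 0 then 0 else Complex.exp (x * d j))

lemma greenKernel_eq (hP : IsUnit P.det) (hA : A = P * Matrix.diagonal d * P⁻¹) (x : ℝ) :
    greenKernel A x = P * Matrix.diagonal (greenCoef d x) * P⁻¹ := by
  have hexp : NormedSpace.exp ((x : ℂ) • A) =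
      P * Matrix.diagonal (fun j => Complex.exp (x * d j)) * P⁻¹ := by
    rw [hA, ← Matrix.smul_mul, ← Matrix.mul_smul, ← Matrix.diagonal_smul,
      Matrix.exp_conj _ _ ((Matrix.isUnit_iff_isUnit_det P).2 hP), Matrix.exp_diagonal]
    congr 3
    ext j
    rw [Pi.coe_exp, Complex.exp_eq_exp_ℂ]
    simp
  have hone : 1 - stableProj A =
      P * Matrix.diagonal (fun j => if (d j).re < 0 then 0 else 1) * P⁻¹ := by
    have : (1 : Matrix I4 I4 ℂ) = P * 1 * P⁻¹ := by
      rw [Matrix.mul_one, Matrix.mul_nonsing_inv _ hP]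
    rw [stableProj_eq hP hA]
    nth_rw 1 [this]
    rw [← Matrix.sub_mul, ← Matrix.mul_sub, ← Matrix.diagonal_one, Matrix.diagonal_sub]
    congr 3
    ext j
    split_ifs <;> simp
  have hmul : ∀ u v : I4 → ℂ, (P * Matrix.diagonal u * P⁻¹) * (P * Matrix.diagonal v * P⁻¹) =
      P * Matrix.diagonal (fun j => u j * v j) * P⁻¹ := by
    intro u v
    rw [← Matrix.diagonal_mul_diagonal, ← Matrix.mul_assoc, ← Matrix.mul_assoc,
      Matrix.nonsing_inv_mul_cancel_right _ _ hP, ← Matrix.mul_assoc]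
  rw [greenKernel]
  split_ifs with hx
  · rw [hexp, stableProj_eq hP hA, hmul, ← Matrix.neg_mul, ← Matrix.mul_neg, Matrix.diagonal_neg]
    congr 3
    ext j
    simp only [greenCoef, hx, if_true, ]
    split_ifs <;> simp
  · rw [hexp, hone, hmul]
    congr 3
    ext j
    simp only [greenCoef, hx, if_false]
    split_ifs <;> simp

/-- Wherever the exponential survives, `x * Re (d j) ≤ 0`; the case `Re (d j) = 0` is included. -/
lemma norm_greenCoef_le (d : I4 → ℂ) (x : ℝ) (j : I4) : ‖greenCoef d x j‖ ≤ 1 := by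
  unfold greenCoef
  split_ifs with h1 h2 h2
  · rw [norm_neg, Complex.norm_exp, Real.exp_le_one_iff]
    simpa using mul_nonpos_of_nonneg_of_nonpos h1 h2.le
  · simp
  · simp
  · rw [Complex.norm_exp, Real.exp_le_one_iff]
    simpa using mul_nonpos_of_nonpos_of_nonneg (not_le.1 h1).le (not_lt.1 h2)

lemma norm_greenKernel_le (h : IsEigenvectorMatrix A P) (x : ℝ) :
    ‖greenKernel A x‖ ≤ condNumber P := by
  obtain ⟨hP, d, hA⟩ := h
  rw [greenKernel_eq hP hA, condNumber]
  have h1 : ‖Matrix.diagonal (greenCoef d x)‖ ≤ 1 := by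
    rw [Matrix.l2_opNorm_diagonal, pi_norm_le_iff_of_nonneg zero_le_one]
    exact norm_greenCoef_le d x
  calc _ ≤ ‖P * Matrix.diagonal (greenCoef d x)‖ * ‖P⁻¹‖ := norm_mul_le _ _
    _ ≤ ‖P‖ * ‖Matrix.diagonal (greenCoef d x)‖ * ‖P⁻¹‖ := by gcongr; exact norm_mul_le _ _
    _ ≤ ‖P‖ * 1 * ‖P⁻¹‖ := by gcongr
    _ = _ := by rw [mul_one]

lemma measurable_greenKernel (h : IsEigenvectorMatrix A P) (i j : I4) :
    Measurable fun x => greenKernel A x i j := by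
  obtain ⟨hP, d, hA⟩ := h
  have hm : ∀ k, Measurable fun x => greenCoef d x k := fun k => by
    unfold greenCoef
    refine Measurable.ite measurableSet_Ici ?_ ?_ <;> split_ifs <;> fun_prop
  simp only [greenKernel_eq hP hA, Matrix.mul_apply, Matrix.diagonal_apply]
  refine Finset.measurable_sum _ fun k _ => Measurable.mul_const ?_ _
  refine Finset.measurable_sum _ fun l _ => Measurable.const_mul ?_ _
  split_ifs with hlk
  exacts [hm l, measurable_const]

end Green

end CGLE

end
noncomputable section

namespace CGLE

/-! ### Absolute values of matrices -/

section AbsPow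

lemma absPow_eq_cfc (M : Matrix (Fin 2) (Fin 2) ℂ) (s : ℝ) :
    absPow M s = cfc (fun t : ℝ => √t ^ s) (Mᴴ * M) :=
  (Matrix.IsHermitian.cfc_eq _ _).symm

lemma continuousOn_spectrum_matrix {n : Type*} [Fintype n] [DecidableEq n] (f : ℝ → ℝ)
    (A : Matrix n n ℂ) : ContinuousOn f (spectrum ℝ A) :=
  Matrix.finite_real_spectrum.continuousOn f

lemma nonneg_of_mem_spectrum {n : Type*} [Fintype n] [DecidableEq n] (M : Matrix n n ℂ)
    {t : ℝ} (ht : t ∈ spectrum ℝ (Mᴴ * M)) : 0 ≤ t := by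
  have h := Matrix.isHermitian_conjTranspose_mul_self M
  rw [h.spectrum_real_eq_range_eigenvalues] at ht
  obtain ⟨i, rfl⟩ := ht
  exact Matrix.eigenvalues_conjTranspose_mul_self_nonneg M i

lemma isSelfAdjoint_conjTranspose_mul_self {n : Type*} [Fintype n] (M : Matrix n n ℂ) :
    IsSelfAdjoint (Mᴴ * M) :=
  Matrix.isHermitian_conjTranspose_mul_self M

lemma absPow_isSelfAdjoint (M : Matrix (Fin 2) (Fin 2) ℂ) (s : ℝ) : (absPow M s)ᴴ = absPow M s := by
  rw [absPow_eq_cfc]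
  exact cfc_predicate (p := IsSelfAdjoint) _ _

lemma absPow_half_mul_self (M : Matrix (Fin 2) (Fin 2) ℂ) :
    absPow M (1 / 2) * absPow M (1 / 2) = cfc (fun t : ℝ => √t) (Mᴴ * M) := by
  rw [absPow_eq_cfc, ← cfc_mul _ _ _ (continuousOn_spectrum_matrix _ _)
    (continuousOn_spectrum_matrix _ _)]
  refine cfc_congr fun t _ => ?_
  rw [← Real.sqrt_eq_rpow, Real.mul_self_sqrt (Real.sqrt_nonneg _)]

/-- The C*-identity, used for `|M|^(1/2)`, for `|M|` and for `M`, reduces this to `|M|² = Mᴴ M`. -/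
lemma norm_absPow_half_sq (M : Matrix (Fin 2) (Fin 2) ℂ) : ‖absPow M (1 / 2)‖ ^ 2 = ‖M‖ := by
  have h1 : ‖absPow M (1 / 2) * absPow M (1 / 2)‖ = ‖absPow M (1 / 2)‖ ^ 2 := by
    have := Matrix.l2_opNorm_conjTranspose_mul_self (absPow M (1 / 2))
    rw [absPow_isSelfAdjoint] at this
    rw [this, sq]
  have hsa : (cfc (fun t : ℝ => √t) (Mᴴ * M))ᴴ = cfc (fun t : ℝ => √t) (Mᴴ * M) :=
    cfc_predicate (p := IsSelfAdjoint) _ _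
  have hsq : cfc (fun t : ℝ => √t) (Mᴴ * M) * cfc (fun t : ℝ => √t) (Mᴴ * M) = Mᴴ * M := by
    rw [← cfc_mul _ _ _ (continuousOn_spectrum_matrix _ _) (continuousOn_spectrum_matrix _ _)]
    conv_rhs => rw [← cfc_id' ℝ (Mᴴ * M) (isSelfAdjoint_conjTranspose_mul_self M)]
    exact cfc_congr fun t ht => Real.mul_self_sqrt (nonneg_of_mem_spectrum M ht)
  have h2 : ‖cfc (fun t : ℝ => √t) (Mᴴ * M)‖ * ‖cfc (fun t : ℝ => √t) (Mᴴ * M)‖ = ‖M‖ * ‖M‖ := by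
    rw [← Matrix.l2_opNorm_conjTranspose_mul_self, hsa, hsq,
      Matrix.l2_opNorm_conjTranspose_mul_self]
  rw [← h1, absPow_half_mul_self]
  exact (mul_self_inj (norm_nonneg _) (norm_nonneg _)).1 h2

/-- With `X = M |M|^(-1/2)` one has `Xᴴ X = |M|`, also for singular `M`. -/
lemma norm_mul_absPow_neg_half_sq (M : Matrix (Fin 2) (Fin 2) ℂ) :
    ‖M * absPow M (-(1 / 2))‖ ^ 2 = ‖M‖ := by
  have h : (M * absPow M (-(1 / 2)))ᴴ * (M * absPow M (-(1 / 2))) =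
      absPow M (1 / 2) * absPow M (1 / 2) := by
    rw [Matrix.conjTranspose_mul, absPow_isSelfAdjoint, Matrix.mul_assoc, ← Matrix.mul_assoc Mᴴ,
      absPow_half_mul_self, absPow_eq_cfc]
    conv_lhs =>
      enter [2, 1]
      rw [← cfc_id' ℝ (Mᴴ * M) (isSelfAdjoint_conjTranspose_mul_self M)]
    rw [← cfc_mul _ _ _ (continuousOn_spectrum_matrix _ _) (continuousOn_spectrum_matrix _ _),
      ← cfc_mul _ _ _ (continuousOn_spectrum_matrix _ _) (continuousOn_spectrum_matrix _ _)]
    refine cfc_congr fun t ht => ?_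
    have ht0 := nonneg_of_mem_spectrum M ht
    rcases (Real.sqrt_nonneg t).eq_or_lt with h0 | h0
    -- On the kernel, `0 ^ (-1/2) = 0` makes both sides vanish.
    · rw [← h0, Real.zero_rpow (by norm_num), zero_mul]
    · have h1 : √t ^ (-(1 / 2) : ℝ) * √t ^ (-(1 / 2) : ℝ) = (√t)⁻¹ := by
        rw [← Real.rpow_add h0, ← Real.rpow_neg_one]
        norm_num
      calc √t ^ (-(1 / 2) : ℝ) * (t * √t ^ (-(1 / 2) : ℝ))
          = t * (√t ^ (-(1 / 2) : ℝ) * √t ^ (-(1 / 2) : ℝ)) := by ring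
        _ = (√t * √t) * (√t)⁻¹ := by rw [h1, Real.mul_self_sqrt ht0]
        _ = √t := by field_simp
  have h' := Matrix.l2_opNorm_conjTranspose_mul_self (absPow M (1 / 2))
  rw [absPow_isSelfAdjoint] at h'
  rw [sq, ← Matrix.l2_opNorm_conjTranspose_mul_self, h, h', ← sq, norm_absPow_half_sq]

/-- The functional calculus with a pointwise limit of continuous functions preserves measurability
of Hermitian matrix functions. -/
lemma measurable_cfc_entry {n : Type*} [Fintype n] [DecidableEq n] {f : ℝ → ℝ} {g : ℕ → ℝ → ℝ}
    (hg : ∀ k, Continuous (g k)) (hgf : ∀ t, Tendsto (fun k => g k t) atTop (𝓝 (f t)))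
    {A : ℝ → Matrix n n ℂ} (hA : ∀ x, (A x).IsHermitian)
    (hm : ∀ i j, Measurable fun x => A x i j) (i j : n) :
    Measurable fun x => cfc f (A x) i j := by
  -- Weierstrass approximation on growing intervals: any fixed `t` is eventually covered, so the
  -- polynomials still converge pointwise to `f`, and polynomials of `A` have measurable entries.
  have hp : ∀ k : ℕ, ∃ q : Polynomial ℝ, ∀ t ∈ Set.Icc (-(k : ℝ)) k,
      |q.eval t - g k t| < 1 / ((k : ℝ) + 1) := fun k =>
    exists_polynomial_near_of_continuousOn _ _ _ (hg k).continuousOn _ (by positivity)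
  choose q hq using hp
  have hqf : ∀ t, Tendsto (fun k => (q k).eval t) atTop (𝓝 (f t)) := by
    intro t
    have h1 : Tendsto (fun k => (q k).eval t - g k t) atTop (𝓝 0) := by
      refine squeeze_zero_norm' ?_ tendsto_one_div_add_atTop_nhds_zero_nat
      filter_upwards [eventually_ge_atTop ⌈|t|⌉₊] with k hk
      have h2 : |t| ≤ k := Nat.ceil_le.1 hk
      exact (hq k t (abs_le.1 h2)).le
    simpa using h1.add (hgf t)
  refine measurable_of_tendsto_metrizable (f := fun k x => cfc (q k).eval (A x) i j) ?_ ?_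
  · intro k
    have hpow : ∀ (m : ℕ) (i j : n), Measurable fun x => (A x ^ m) i j := by
      intro m
      induction m with
      | zero => intro i j; simp only [pow_zero]; exact measurable_const
      | succ m ih =>
        intro i j
        simp only [pow_succ, Matrix.mul_apply]
        exact Finset.measurable_sum _ fun l _ => (ih i l).mul (hm l j)
    have he : ∀ x, cfc (q k).eval (A x) i j =
        ∑ m ∈ (q k).support, ((q k).coeff m : ℂ) * (A x ^ m) i j := by
      intro x
      have h := cfc_polynomial (q k) (A x) (show IsSelfAdjoint (A x) from hA x)
      rw [Polynomial.aeval_def, Polynomial.eval₂_eq_sum, Polynomial.sum] at h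
      have h' := congrFun (congrFun h i) j
      rw [Matrix.sum_apply] at h'
      refine h'.trans (Finset.sum_congr rfl fun m _ => ?_)
      rw [← Algebra.smul_def]
      simp [Matrix.smul_apply]
    simp only [he]
    exact Finset.measurable_sum _ fun m _ => (hpow m i j).const_mul _
  -- At fixed `x` only the finitely many eigenvalues of `A x` matter, so pointwise convergence is
  -- enough.
  · rw [tendsto_pi_nhds]
    intro x
    simp only [(hA x).cfc_eq, Matrix.IsHermitian.cfc, Unitary.conjStarAlgAut_apply,
      Matrix.mul_apply, Matrix.diagonal_apply]
    refine tendsto_finsetSum _ fun k _ => Tendsto.mul_const _ ?_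
    refine tendsto_finsetSum _ fun l _ => Tendsto.const_mul _ ?_
    split_ifs
    · exact (Complex.continuous_ofReal.tendsto _).comp (hqf _)
    · exact tendsto_const_nhds

variable {p : Params} {ψ : ℝ → ℂ}

lemma measurable_matM (hψ : Measurable ψ) (i j : Fin 2) : Measurable fun x => matM p ψ x i j := by
  have h1 : ∀ i, Measurable fun x => psiVec ψ x i := by
    intro i
    fin_cases i <;> simp [psiVec] <;> fun_prop
  simp only [matM, matMtilde, Matrix.add_apply, Matrix.sub_apply, Matrix.smul_apply,
    Matrix.mul_apply, Matrix.vecMulVec_apply, smul_eq_mul]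
  have := h1 j
  have h2 : ∀ k, Measurable fun x => ((2 * matN1 p i k + 4 * (‖ψ x‖ : ℂ) ^ 2 * matN2 p i k) *
      (psiVec ψ x k * psiVec ψ x j)) := fun k => by
    have := h1 k
    fun_prop
  fun_prop

lemma measurable_conjTranspose_mul_self {n : Type*} [Fintype n] {A : ℝ → Matrix n n ℂ}
    (hm : ∀ i j, Measurable fun x => A x i j) (i j : n) :
    Measurable fun x => ((A x)ᴴ * A x) i j := by
  simp only [Matrix.mul_apply, Matrix.conjTranspose_apply]
  refine Finset.measurable_sum _ fun k _ => Measurable.mul ?_ (hm k j)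
  exact Complex.continuous_conj.measurable.comp (hm k i)

lemma measurable_absPow_half (hψ : Measurable ψ) (i j : Fin 2) :
    Measurable fun x => absPow (matM p ψ x) (1 / 2) i j := by
  simp only [absPow_eq_cfc]
  refine measurable_cfc_entry (g := fun _ t => √t ^ (1 / 2 : ℝ)) (fun _ => ?_)
    (fun _ => tendsto_const_nhds) (fun x => Matrix.isHermitian_conjTranspose_mul_self _)
    (measurable_conjTranspose_mul_self (measurable_matM hψ)) i j
  exact Real.continuous_sqrt.rpow_const fun _ => Or.inr (by norm_num)

/-- The negative power is discontinuous at 0. The quotients `√t^(1/2) / (√t + 1/(k+1))` are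
continuous and converge to it everywhere, with the value 0 where `√t = 0`. -/
lemma measurable_absPow_neg_half (hψ : Measurable ψ) (i j : Fin 2) :
    Measurable fun x => absPow (matM p ψ x) (-(1 / 2)) i j := by
  simp only [absPow_eq_cfc]
  refine measurable_cfc_entry (g := fun k t => √t ^ (1 / 2 : ℝ) / (√t + 1 / ((k : ℝ) + 1)))
    (fun k => ?_) (fun t => ?_) (fun x => Matrix.isHermitian_conjTranspose_mul_self _)
    (measurable_conjTranspose_mul_self (measurable_matM hψ)) i j
  · refine Continuous.div (Real.continuous_sqrt.rpow_const fun _ => Or.inr (by norm_num))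
      (by fun_prop) fun t => ?_
    positivity
  · rcases (Real.sqrt_nonneg t).eq_or_lt with h0 | h0
    · rw [← h0, Real.zero_rpow (by norm_num), Real.zero_rpow (by norm_num)]
      simp
    · have h1 : √t ^ (-(1 / 2) : ℝ) = √t ^ (1 / 2 : ℝ) / (√t + 0) := by
        rw [add_zero, eq_div_iff h0.ne']
        nth_rw 2 [← Real.rpow_one (√t)]
        rw [← Real.rpow_add h0]
        norm_num
      rw [h1]
      exact tendsto_const_nhds.div (tendsto_const_nhds.add tendsto_one_div_add_atTop_nhds_zero_nat)
        (by rw [add_zero]; exact h0.ne')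

/-! ### Bounds for the factors of `R` -/

lemma norm_fromRows_one_zero :
    ‖(Matrix.fromRows 1 0 : Matrix I4 (Fin 2) ℂ)‖ = 1 := by
  have h := Matrix.l2_opNorm_conjTranspose_mul_self (Matrix.fromRows 1 0 : Matrix I4 (Fin 2) ℂ)
  rw [Matrix.conjTranspose_fromRows_eq_fromCols_conjTranspose, Matrix.fromCols_mul_fromRows] at h
  simp only [Matrix.conjTranspose_one, mul_one, Matrix.conjTranspose_zero, mul_zero, add_zero,
    norm_one] at h
  exact (mul_self_inj (norm_nonneg _) zero_le_one).1 (by rw [← h, mul_one])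

lemma norm_fromRows_zero_one :
    ‖(Matrix.fromRows 0 1 : Matrix I4 (Fin 2) ℂ)‖ = 1 := by
  have h := Matrix.l2_opNorm_conjTranspose_mul_self (Matrix.fromRows 0 1 : Matrix I4 (Fin 2) ℂ)
  rw [Matrix.conjTranspose_fromRows_eq_fromCols_conjTranspose, Matrix.fromCols_mul_fromRows] at h
  simp only [Matrix.conjTranspose_one, mul_one, Matrix.conjTranspose_zero, mul_zero, zero_add,
    norm_one] at h
  exact (mul_self_inj (norm_nonneg _) zero_le_one).1 (by rw [← h, mul_one])

lemma norm_fromBlocks_upper_left_le (X : Matrix (Fin 2) (Fin 2) ℂ) :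
    ‖(Matrix.fromBlocks X 0 0 0 : Matrix I4 I4 ℂ)‖ ≤ ‖X‖ := by
  have h : (Matrix.fromBlocks X 0 0 0 : Matrix I4 I4 ℂ) =
      (Matrix.fromRows 1 0 : Matrix I4 (Fin 2) ℂ) * X * (Matrix.fromRows 1 0 : Matrix I4 (Fin 2) ℂ)ᴴ := by
    rw [Matrix.conjTranspose_fromRows_eq_fromCols_conjTranspose, Matrix.fromRows_mul,
      Matrix.fromRows_mul_fromCols]
    simp
  calc _ ≤ ‖(Matrix.fromRows 1 0 * X : Matrix I4 (Fin 2) ℂ)‖ *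
        ‖(Matrix.fromRows 1 0 : Matrix I4 (Fin 2) ℂ)ᴴ‖ := h ▸ Matrix.l2_opNorm_mul _ _
    _ ≤ (‖(Matrix.fromRows 1 0 : Matrix I4 (Fin 2) ℂ)‖ * ‖X‖) *
        ‖(Matrix.fromRows 1 0 : Matrix I4 (Fin 2) ℂ)ᴴ‖ := by
      gcongr; exact Matrix.l2_opNorm_mul _ _
    _ = ‖X‖ := by rw [Matrix.l2_opNorm_conjTranspose, norm_fromRows_one_zero, one_mul, mul_one]

/-- Sandwich with the isometric inclusions of the two summands. Equality matters, since the decay of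
`M` must be recovered from that of `R`. -/
lemma norm_fromBlocks_lower_left (X : Matrix (Fin 2) (Fin 2) ℂ) :
    ‖(Matrix.fromBlocks 0 0 X 0 : Matrix I4 I4 ℂ)‖ = ‖X‖ := by
  refine le_antisymm ?_ ?_
  · have h : (Matrix.fromBlocks 0 0 X 0 : Matrix I4 I4 ℂ) =
        (Matrix.fromRows 0 1 : Matrix I4 (Fin 2) ℂ) * X * (Matrix.fromRows 1 0 : Matrix I4 (Fin 2) ℂ)ᴴ := by
      rw [Matrix.conjTranspose_fromRows_eq_fromCols_conjTranspose, Matrix.fromRows_mul,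
        Matrix.fromRows_mul_fromCols]
      simp
    calc _ ≤ ‖(Matrix.fromRows 0 1 * X : Matrix I4 (Fin 2) ℂ)‖ *
          ‖(Matrix.fromRows 1 0 : Matrix I4 (Fin 2) ℂ)ᴴ‖ := h ▸ Matrix.l2_opNorm_mul _ _
      _ ≤ (‖(Matrix.fromRows 0 1 : Matrix I4 (Fin 2) ℂ)‖ * ‖X‖) *
          ‖(Matrix.fromRows 1 0 : Matrix I4 (Fin 2) ℂ)ᴴ‖ := by
        gcongr; exact Matrix.l2_opNorm_mul _ _
      _ = ‖X‖ := by
        rw [Matrix.l2_opNorm_conjTranspose, norm_fromRows_one_zero, norm_fromRows_zero_one,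
          one_mul, mul_one]
  · set Y : Matrix I4 I4 ℂ := Matrix.fromBlocks 0 0 X 0 with hY
    have h : X = (Matrix.fromRows 0 1 : Matrix I4 (Fin 2) ℂ)ᴴ *
        (Y * (Matrix.fromRows 1 0 : Matrix I4 (Fin 2) ℂ)) := by
      rw [Matrix.conjTranspose_fromRows_eq_fromCols_conjTranspose, hY,
        ← Matrix.fromRows_fromCols_eq_fromBlocks, Matrix.fromRows_mul,
        Matrix.fromCols_mul_fromRows, Matrix.fromCols_mul_fromRows, Matrix.fromCols_mul_fromRows]
      simp
    calc ‖X‖ ≤ ‖(Matrix.fromRows 0 1 : Matrix I4 (Fin 2) ℂ)ᴴ‖ *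
          ‖Y * (Matrix.fromRows 1 0 : Matrix I4 (Fin 2) ℂ)‖ := by
          conv_lhs => rw [h]
          exact Matrix.l2_opNorm_mul _ _
      _ ≤ ‖(Matrix.fromRows 0 1 : Matrix I4 (Fin 2) ℂ)ᴴ‖ *
          (‖Y‖ * ‖(Matrix.fromRows 1 0 : Matrix I4 (Fin 2) ℂ)‖) := by
        gcongr; exact Matrix.l2_opNorm_mul _ _
      _ = ‖Y‖ := by
        rw [Matrix.l2_opNorm_conjTranspose, norm_fromRows_one_zero, norm_fromRows_zero_one,
          one_mul, mul_one]

/-- The modulus `|B| = |β + i D / 2|` of the diffusion matrix. -/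
def absB (p : Params) : ℝ := √(p.β ^ 2 + (p.D / 2) ^ 2)

lemma absB_pos (hp : (p.D, p.β) ≠ (0, 0)) : 0 < absB p :=
  Real.sqrt_pos.2 (sq_add_sq_pos_of_ne hp)

lemma absB_mul_norm_matB_inv_mul (hp : (p.D, p.β) ≠ (0, 0)) (X : Matrix (Fin 2) (Fin 2) ℂ) :
    absB p * ‖(matB p)⁻¹ * X‖ = ‖X‖ := by
  rw [absB, ← norm_matB_mul, Matrix.mul_nonsing_inv_cancel_left _ _
    (det_matB_ne_zero hp).isUnit]

lemma norm_matM (hp : (p.D, p.β) ≠ (0, 0)) (x : ℝ) :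
    ‖matM p ψ x‖ = absB p * ‖matR p ψ x‖ := by
  rw [matR, norm_fromBlocks_lower_left, norm_neg, absB_mul_norm_matB_inv_mul hp]

lemma norm_matRr_sq_le (hp : (p.D, p.β) ≠ (0, 0)) (x : ℝ) :
    ‖matRr p ψ x‖ ^ 2 ≤ absB p * ‖matR p ψ x‖ := by
  rw [← norm_matM hp, ← norm_absPow_half_sq]
  gcongr
  exact norm_fromBlocks_upper_left_le _

/-- The factor `1 / |B|` offsets the factor `|B|` in `norm_matRr_sq_le`. -/
lemma norm_matRl_sq (hp : (p.D, p.β) ≠ (0, 0)) (x : ℝ) :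
    ‖matRl p ψ x‖ ^ 2 = ‖matR p ψ x‖ / absB p := by
  have h0 := absB_pos hp
  have h := norm_mul_absPow_neg_half_sq (matM p ψ x)
  rw [norm_matM hp, ← absB_mul_norm_matB_inv_mul hp] at h
  rw [matRl, norm_fromBlocks_lower_left, norm_neg, eq_div_iff h0.ne']
  refine mul_left_cancel₀ h0.ne' ?_
  rw [← h]
  ring

lemma measurable_matRr (hψ : Measurable ψ) (i j : I4) : Measurable fun x => matRr p ψ x i j := by
  rcases i with i | i <;> rcases j with j | j <;> simp only [matRr, Matrix.fromBlocks_apply₁₁,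
    Matrix.fromBlocks_apply₁₂, Matrix.fromBlocks_apply₂₁, Matrix.fromBlocks_apply₂₂]
  exacts [measurable_absPow_half hψ i j, measurable_const, measurable_const, measurable_const]

lemma measurable_matRl (hψ : Measurable ψ) (i j : I4) : Measurable fun x => matRl p ψ x i j := by
  rcases i with i | i <;> rcases j with j | j <;> simp only [matRl, Matrix.fromBlocks_apply₁₁,
    Matrix.fromBlocks_apply₁₂, Matrix.fromBlocks_apply₂₁, Matrix.fromBlocks_apply₂₂]
  · exact measurable_const
  · exact measurable_const
  · simp only [Matrix.neg_apply, Matrix.mul_apply]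
    refine (Finset.measurable_sum _ fun k _ => Measurable.const_mul ?_ _).neg
    exact Finset.measurable_sum _ fun l _ =>
      (measurable_matM hψ k l).mul (measurable_absPow_neg_half hψ l j)
  · exact measurable_const

end AbsPow

end CGLE

end
noncomputable section

namespace CGLE

/-! ### Operators on `L²` given by pointwise formulas -/

section PointwiseOperators

variable {n m : Type} [Fintype n] [Fintype m]

lemma norm_sq_eq_integral (u : L2 n) : ‖u‖ ^ 2 = ∫ x, ‖u x‖ ^ 2 := by
  have h : inner ℂ u u = ∫ x, inner ℂ (u x) (u x) := L2.inner_def u u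
  simp_rw [inner_self_eq_norm_sq_to_K] at h
  have h' : ((‖u‖ ^ 2 : ℝ) : ℂ) = ((∫ x, ‖u x‖ ^ 2 : ℝ) : ℂ) := by
    rw [← integral_complex_ofReal]
    push_cast
    exact h
  exact_mod_cast h'

lemma integrable_norm_sq (u : L2 n) : Integrable fun x => ‖u x‖ ^ 2 :=
  (memLp_two_iff_integrable_sq_norm (Lp.aestronglyMeasurable u)).1 (Lp.memLp u)

lemma memLp_two_of_norm_sq_le {f : ℝ → EuclideanSpace ℂ n} (hf : AEStronglyMeasurable f volume)
    {g : ℝ → ℝ} (hg : Integrable g) (h : ∀ x, ‖f x‖ ^ 2 ≤ g x) : MemLp f 2 volume := by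
  rw [memLp_two_iff_integrable_sq_norm hf]
  refine hg.mono' (hf.norm.pow 2) (.of_forall fun x => ?_)
  rw [Real.norm_of_nonneg (by positivity)]
  exact h x

lemma norm_toLp_sq_le {f : ℝ → EuclideanSpace ℂ n} (hf : MemLp f 2 volume)
    {g : ℝ → ℝ} (hg : Integrable g) (h : ∀ x, ‖f x‖ ^ 2 ≤ g x) :
    ‖(hf.toLp f : L2 n)‖ ^ 2 ≤ ∫ x, g x := by
  rw [norm_sq_eq_integral]
  refine integral_mono_ae (integrable_norm_sq _) hg ?_
  filter_upwards [hf.coeFn_toLp] with x hx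
  rw [hx]
  exact h x

/-- A pointwise formula that is additive, homogeneous and bounded almost everywhere defines a
bounded operator on `L²`. -/
lemma exists_clm_of_pointwise (Φ : L2 n → ℝ → EuclideanSpace ℂ m)
    (hΦ : ∀ u, AEStronglyMeasurable (Φ u) volume)
    (hadd : ∀ u v, Φ (u + v) =ᵐ[volume] Φ u + Φ v)
    (hsmul : ∀ (c : ℂ) u, Φ (c • u) =ᵐ[volume] c • Φ u)
    (g : L2 n → ℝ → ℝ) (hg : ∀ u, Integrable (g u)) (hle : ∀ u x, ‖Φ u x‖ ^ 2 ≤ g u x)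
    {C : ℝ} (hC : 0 ≤ C) (hbound : ∀ u, ∫ x, g u x ≤ C ^ 2 * ‖u‖ ^ 2) :
    ∃ T : L2 n →L[ℂ] L2 m, ∀ u, T u =ᵐ[volume] Φ u := by
  have hmem : ∀ u, MemLp (Φ u) 2 volume := fun u => memLp_two_of_norm_sq_le (hΦ u) (hg u) (hle u)
  let T₀ : L2 n →ₗ[ℂ] L2 m :=
    { toFun := fun u => (hmem u).toLp (Φ u)
      map_add' := fun u v => by
        rw [← MemLp.toLp_add]
        exact MemLp.toLp_congr _ _ (hadd u v)
      map_smul' := fun c u => by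
        rw [RingHom.id_apply, ← MemLp.toLp_const_smul]
        exact MemLp.toLp_congr _ _ (hsmul c u) }
  refine ⟨T₀.mkContinuous C fun u => ?_, fun u => (hmem u).coeFn_toLp⟩
  refine (pow_le_pow_iff_left₀ (norm_nonneg _) (by positivity) two_ne_zero).1 ?_
  rw [mul_pow]
  exact (norm_toLp_sq_le (hmem u) (hg u) (hle u)).trans (hbound u)

lemma measurable_coe_L2 (u : L2 n) : Measurable u := (Lp.stronglyMeasurable u).measurable

variable [DecidableEq n] [DecidableEq m]

lemma act_mul (A B : Matrix n n ℂ) (v : EuclideanSpace ℂ n) : act (A * B) v = act A (act B v) := by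
  simp [act, map_mul]

lemma act_add (A B : Matrix n n ℂ) (v : EuclideanSpace ℂ n) :
    act (A + B) v = act A v + act B v := by
  simp [act, map_add]

lemma act_sub (A B : Matrix n n ℂ) (v : EuclideanSpace ℂ n) :
    act (A - B) v = act A v - act B v := by
  simp [act, map_sub]

lemma act_map_add (A : Matrix n n ℂ) (v w : EuclideanSpace ℂ n) :
    act A (v + w) = act A v + act A w := by
  simp [act]

lemma act_map_smul (A : Matrix n n ℂ) (c : ℂ) (v : EuclideanSpace ℂ n) :
    act A (c • v) = c • act A v := by
  simp [act]

lemma norm_act_le (A : Matrix n n ℂ) (v : EuclideanSpace ℂ n) : ‖act A v‖ ≤ ‖A‖ * ‖v‖ :=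
  (Matrix.toEuclideanCLM (𝕜 := ℂ) A).le_opNorm v

lemma inner_act_right (A : Matrix n n ℂ) (v w : EuclideanSpace ℂ n) :
    inner ℂ v (act A w) = inner ℂ (act Aᴴ v) w := by
  have h : Matrix.toEuclideanCLM (n := n) (𝕜 := ℂ) Aᴴ =
      ContinuousLinearMap.adjoint (Matrix.toEuclideanCLM (𝕜 := ℂ) A) :=
    map_star (Matrix.toEuclideanCLM (𝕜 := ℂ)) A
  rw [act, act, h, ContinuousLinearMap.adjoint_inner_left]

lemma act_apply (A : Matrix n n ℂ) (v : EuclideanSpace ℂ n) (i : n) :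
    act A v i = ∑ j, A i j * v j := by
  rw [act, Matrix.ofLp_toEuclideanCLM]
  rfl

lemma measurable_act {α : Type*} [MeasurableSpace α] {A : α → Matrix n n ℂ}
    {v : α → EuclideanSpace ℂ n} (hA : ∀ i j, Measurable fun x => A x i j) (hv : Measurable v) :
    Measurable fun x => act (A x) (v x) := by
  have h : (fun x => act (A x) (v x)) = fun x => WithLp.toLp 2 fun i => ∑ j, A x i j * v x j := by
    ext x i
    exact act_apply _ _ _
  rw [h]
  refine (WithLp.measurable_toLp 2 _).comp (measurable_pi_lambda _ fun i => ?_)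
  refine Finset.measurable_sum _ fun j _ => (hA i j).mul ?_
  exact (measurable_pi_apply j).comp ((WithLp.measurable_ofLp 2 _).comp hv)

/-- Multiplication by a bounded measurable matrix function is a bounded operator on `L²`. -/
lemma exists_clm_act {A : ℝ → Matrix n n ℂ} (hA : ∀ i j, Measurable fun x => A x i j) {C : ℝ}
    (hC : ∀ x, ‖A x‖ ≤ C) : ∃ T : L2 n →L[ℂ] L2 n, ∀ u, ∀ᵐ x, T u x = act (A x) (u x) := by
  have hC0 : 0 ≤ C := (norm_nonneg _).trans (hC 0)
  refine exists_clm_of_pointwise (fun u x => act (A x) (u x))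
    (fun u => (measurable_act hA (measurable_coe_L2 u)).aestronglyMeasurable) ?_ ?_
    (fun u x => C ^ 2 * ‖u x‖ ^ 2) (fun u => (integrable_norm_sq u).const_mul _) ?_ hC0 ?_
  · intro u v
    filter_upwards [Lp.coeFn_add u v] with x hx
    rw [hx, Pi.add_apply, act_map_add]
    rfl
  · intro c u
    filter_upwards [Lp.coeFn_smul c u] with x hx
    rw [hx, Pi.smul_apply, act_map_smul]
    rfl
  · intro u x
    rw [← mul_pow]
    gcongr
    exact (norm_act_le _ _).trans (by gcongr; exact hC x)
  · intro u
    rw [integral_const_mul, norm_sq_eq_integral]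

/-- The functional `u ↦ ⟪c, ∫ A(y) u(y) dy⟫` on `L²` is represented by a function whose norm is
controlled by the `L²` norm of `A`. -/
lemma exists_inner_eq_integral_act {A : ℝ → Matrix n n ℂ}
    (hA : ∀ i j, Measurable fun x => A x i j) {g : ℝ → ℝ} (hg : Integrable g)
    (hAg : ∀ x, ‖A x‖ ^ 2 ≤ g x) :
    (∀ u : L2 n, Integrable fun y => act (A y) (u y)) ∧
    ∀ c : EuclideanSpace ℂ n, ∃ G : L2 n, ‖G‖ ^ 2 ≤ (∫ x, g x) * ‖c‖ ^ 2 ∧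
      ∀ u : L2 n, inner ℂ c (∫ y, act (A y) (u y)) = inner ℂ G u := by
  have hint : ∀ u : L2 n, Integrable fun y => act (A y) (u y) := by
    intro u
    refine (hg.add (integrable_norm_sq u)).mono'
      (measurable_act hA (measurable_coe_L2 u)).aestronglyMeasurable (.of_forall fun x => ?_)
    have h1 := norm_act_le (A x) (u x)
    simp only [Pi.add_apply]
    nlinarith [hAg x, sq_nonneg (‖A x‖ - ‖u x‖), sq_nonneg ‖u x‖, sq_nonneg ‖A x‖]
  refine ⟨hint, fun c => ?_⟩
  have hAc : ∀ i j, Measurable fun x => (A x)ᴴ i j := fun i j =>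
    Complex.continuous_conj.measurable.comp (hA j i)
  -- The representing function is `x ↦ A(x)ᴴ c`.
  have hle : ∀ x, ‖act (A x)ᴴ c‖ ^ 2 ≤ g x * ‖c‖ ^ 2 := by
    intro x
    calc ‖act (A x)ᴴ c‖ ^ 2 ≤ (‖(A x)ᴴ‖ * ‖c‖) ^ 2 := by gcongr; exact norm_act_le _ _
      _ = ‖A x‖ ^ 2 * ‖c‖ ^ 2 := by rw [Matrix.l2_opNorm_conjTranspose, mul_pow]
      _ ≤ g x * ‖c‖ ^ 2 := by gcongr; exact hAg x
  have hmem : MemLp (fun x => act (A x)ᴴ c) 2 volume := memLp_two_of_norm_sq_le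
    (measurable_act hAc measurable_const).aestronglyMeasurable (hg.mul_const _) hle
  refine ⟨hmem.toLp _, ?_, fun u => ?_⟩
  · rw [← integral_mul_const]
    exact norm_toLp_sq_le hmem (hg.mul_const _) hle
  · rw [← integral_inner (hint u), L2.inner_def]
    refine integral_congr_ae ?_
    filter_upwards [hmem.coeFn_toLp] with x hx
    rw [hx, inner_act_right]

/-- Each coordinate of the integral is the inner product with a fixed `L²` function, to which
Bessel's inequality applies; summing over coordinates costs the dimension. -/
lemma sum_norm_integral_act_sq_le {A : ℝ → Matrix n n ℂ}
    (hA : ∀ i j, Measurable fun x => A x i j) {g : ℝ → ℝ} (hg : Integrable g)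
    (hAg : ∀ x, ‖A x‖ ^ 2 ≤ g x) {ι : Type*} [Fintype ι] {v : ι → L2 n} (hv : Orthonormal ℂ v) :
    ∑ i, ‖∫ y, act (A y) (v i y)‖ ^ 2 ≤ Fintype.card n * ∫ x, g x := by
  obtain ⟨-, h⟩ := exists_inner_eq_integral_act hA hg hAg
  let b := EuclideanSpace.basisFun n ℂ
  calc ∑ i, ‖∫ y, act (A y) (v i y)‖ ^ 2
      = ∑ i, ∑ k, ‖inner ℂ (b k) (∫ y, act (A y) (v i y))‖ ^ 2 := by
        simp_rw [b.sum_sq_norm_inner_right]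
    _ = ∑ k, ∑ i, ‖inner ℂ (b k) (∫ y, act (A y) (v i y))‖ ^ 2 := Finset.sum_comm
    _ ≤ ∑ k : n, ∫ x, g x := by
        refine Finset.sum_le_sum fun k _ => ?_
        obtain ⟨G, hG, hGu⟩ := h (b k)
        rw [b.orthonormal.1 k, one_pow, mul_one] at hG
        refine le_trans ?_ hG
        simp_rw [hGu, norm_inner_symm G]
        exact hv.sum_inner_products_le G (s := Finset.univ)
    _ = Fintype.card n * ∫ x, g x := by simp

/-- Pair the integral with itself and use Cauchy-Schwarz, which avoids the dimension factor. -/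
lemma norm_integral_act_sq_le {A : ℝ → Matrix n n ℂ}
    (hA : ∀ i j, Measurable fun x => A x i j) {g : ℝ → ℝ} (hg : Integrable g)
    (hAg : ∀ x, ‖A x‖ ^ 2 ≤ g x) (u : L2 n) :
    ‖∫ y, act (A y) (u y)‖ ^ 2 ≤ (∫ x, g x) * ‖u‖ ^ 2 := by
  obtain ⟨-, h⟩ := exists_inner_eq_integral_act hA hg hAg
  have hI : 0 ≤ ∫ x, g x := integral_nonneg fun x => (sq_nonneg _).trans (hAg x)
  set w := ∫ y, act (A y) (u y) with hw
  obtain ⟨G, hG, hGu⟩ := h w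
  have h1 : ‖w‖ ^ 2 ≤ ‖G‖ * ‖u‖ := by
    have h2 := norm_inner_le_norm (𝕜 := ℂ) G u
    rw [← hGu, ← hw, inner_self_eq_norm_sq_to_K] at h2
    simpa using h2
  rcases (norm_nonneg w).eq_or_lt with h0 | h0
  · rw [← h0, zero_pow two_ne_zero]
    positivity
  · have h3 : ‖w‖ ^ 2 * ‖w‖ ^ 2 ≤ ((∫ x, g x) * ‖u‖ ^ 2) * ‖w‖ ^ 2 := by
      calc ‖w‖ ^ 2 * ‖w‖ ^ 2 ≤ (‖G‖ * ‖u‖) * (‖G‖ * ‖u‖) := by gcongr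
        _ = ‖G‖ ^ 2 * ‖u‖ ^ 2 := by ring
        _ ≤ ((∫ x, g x) * ‖w‖ ^ 2) * ‖u‖ ^ 2 := by gcongr
        _ = _ := by ring
    exact le_of_mul_le_mul_right h3 (by positivity)

end PointwiseOperators

lemma integral_exp_neg_mul_abs {a : ℝ} (ha : 0 < a) :
    ∫ x : ℝ, Real.exp (-a * |x|) = 2 / a := by
  rw [integral_comp_abs (f := fun x => Real.exp (-a * x)), integral_exp_mul_Ioi (neg_lt_zero.2 ha)]
  simp
  ring

lemma integrable_exp_neg_mul_abs {a : ℝ} (ha : 0 < a) :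
    Integrable fun x : ℝ => Real.exp (-a * |x|) :=
  -- A non-integrable function has Bochner integral 0 by convention, so a nonzero value proves
  -- integrability.
  .of_integral_ne_zero (by rw [integral_exp_neg_mul_abs ha]; positivity)

/-! ### The Birman-Schwinger operator -/

section BirmanSchwinger

variable {p : Params} {ψ : ℝ → ℂ} {lam : ℂ} {C a : ℝ} {P : Matrix I4 I4 ℂ}

lemma nonneg_of_norm_matR_le (hR : ∀ x, ‖matR p ψ x‖ ≤ C * Real.exp (-a * |x|)) : 0 ≤ C := by
  have := (norm_nonneg _).trans (hR 0)
  simpa using this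

lemma norm_matRr_sq_le_exp (hp : (p.D, p.β) ≠ (0, 0))
    (hR : ∀ x, ‖matR p ψ x‖ ≤ C * Real.exp (-a * |x|)) (x : ℝ) :
    ‖matRr p ψ x‖ ^ 2 ≤ absB p * C * Real.exp (-a * |x|) := by
  rw [mul_assoc]
  exact (norm_matRr_sq_le hp x).trans
    (mul_le_mul_of_nonneg_left (hR x) (absB_pos hp).le)

lemma condNumber_nonneg (P : Matrix I4 I4 ℂ) : 0 ≤ condNumber P := by
  unfold condNumber; positivity

lemma norm_greenKernel_mul_matRl_sq_le (hp : (p.D, p.β) ≠ (0, 0))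
    (hR : ∀ x, ‖matR p ψ x‖ ≤ C * Real.exp (-a * |x|))
    (hP : IsEigenvectorMatrix (matA p lam) P) (x y : ℝ) :
    ‖greenKernel (matA p lam) (x - y) * matRl p ψ y‖ ^ 2 ≤
      condNumber P ^ 2 * (C / absB p) * Real.exp (-a * |y|) := by
  have h0 := absB_pos hp
  calc ‖greenKernel (matA p lam) (x - y) * matRl p ψ y‖ ^ 2
      ≤ (condNumber P * ‖matRl p ψ y‖) ^ 2 := by
        gcongr
        refine (norm_mul_le _ _).trans ?_
        gcongr
        exact norm_greenKernel_le hP _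
    _ = condNumber P ^ 2 * (‖matR p ψ y‖ / absB p) := by rw [mul_pow, norm_matRl_sq hp]
    _ ≤ condNumber P ^ 2 * ((C * Real.exp (-a * |y|)) / absB p) := by gcongr; exact hR y
    _ = _ := by ring

lemma measurable_greenKernel_mul_matRl (hψ : Measurable ψ)
    (hP : IsEigenvectorMatrix (matA p lam) P) (x : ℝ) (i j : I4) :
    Measurable fun y => (greenKernel (matA p lam) (x - y) * matRl p ψ y) i j := by
  simp only [Matrix.mul_apply]
  refine Finset.measurable_sum _ fun k _ => Measurable.mul ?_ (measurable_matRl hψ k j)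
  exact (measurable_greenKernel hP i k).comp (measurable_const.sub measurable_id)

lemma integral_const_mul_exp_neg_mul_abs (ha : 0 < a) (c : ℝ) :
    ∫ y : ℝ, c * Real.exp (-a * |y|) = c * (2 / a) := by
  rw [integral_const_mul, integral_exp_neg_mul_abs ha]

/-- The Birman-Schwinger operator is a well defined bounded operator. -/
lemma exists_isBirmanSchwinger (hp : (p.D, p.β) ≠ (0, 0)) (hψ : Measurable ψ) (ha : 0 < a)
    (hR : ∀ x, ‖matR p ψ x‖ ≤ C * Real.exp (-a * |x|))
    (hP : IsEigenvectorMatrix (matA p lam) P) :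
    ∃ K : L2 I4 →L[ℂ] L2 I4, IsBirmanSchwinger p ψ lam K := by
  have hC := nonneg_of_norm_matR_le hR
  have h0 := absB_pos hp
  set A := matA p lam with hA
  have hgi := (integrable_exp_neg_mul_abs ha).const_mul (condNumber P ^ 2 * (C / absB p))
  have hker : ∀ x, (∀ i j, Measurable fun y => (greenKernel A (x - y) * matRl p ψ y) i j) :=
    measurable_greenKernel_mul_matRl hψ hP
  have hle := norm_greenKernel_mul_matRl_sq_le hp hR hP
  have hint : ∀ (x : ℝ) (u : L2 I4),
      Integrable fun y => act (greenKernel A (x - y) * matRl p ψ y) (u y) := fun x =>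
    (exists_inner_eq_integral_act (hker x) hgi (hle x)).1
  -- The integrand is jointly measurable in `(x, y)`, so the parametric integral is measurable.
  have hmeas : ∀ u : L2 I4, StronglyMeasurable fun x =>
      ∫ y, act (greenKernel A (x - y) * matRl p ψ y) (u y) := by
    intro u
    refine StronglyMeasurable.integral_prod_right (Measurable.stronglyMeasurable ?_)
    refine measurable_act (α := ℝ × ℝ)
      (A := fun z => greenKernel A (z.1 - z.2) * matRl p ψ z.2) (fun i j => ?_)
      ((measurable_coe_L2 u).comp measurable_snd)
    simp only [Matrix.mul_apply]
    refine Finset.measurable_sum _ fun k _ => Measurable.mul ?_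
      ((measurable_matRl hψ k j).comp measurable_snd)
    exact (measurable_greenKernel hP i k).comp (measurable_fst.sub measurable_snd)
  obtain ⟨K, hK⟩ := exists_clm_of_pointwise
    (fun (u : L2 I4) x => act (matRr p ψ x)
      (∫ y, act (greenKernel A (x - y) * matRl p ψ y) (u y)))
    (fun u => (measurable_act (measurable_matRr hψ) (hmeas u).measurable).aestronglyMeasurable)
    (fun u v => .of_forall fun x => by
      simp only [Pi.add_apply, ← act_map_add]
      rw [← integral_add (hint x u) (hint x v)]
      congr 1
      refine integral_congr_ae ?_
      filter_upwards [Lp.coeFn_add u v] with y hy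
      rw [hy, Pi.add_apply, act_map_add])
    (fun c u => .of_forall fun x => by
      simp only [Pi.smul_apply, ← act_map_smul]
      rw [← integral_smul]
      congr 1
      refine integral_congr_ae ?_
      filter_upwards [Lp.coeFn_smul c u] with y hy
      rw [hy, Pi.smul_apply, act_map_smul])
    (fun u x => (absB p * C * (condNumber P ^ 2 * (C / absB p) * (2 / a)) * ‖u‖ ^ 2) *
      Real.exp (-a * |x|))
    (fun u => (integrable_exp_neg_mul_abs ha).const_mul _)
    (fun u x => by
      have h1 := norm_integral_act_sq_le (hker x) hgi (hle x) u
      rw [integral_const_mul_exp_neg_mul_abs ha] at h1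
      calc _ ≤ (‖matRr p ψ x‖ * ‖∫ y, act (greenKernel A (x - y) * matRl p ψ y) (u y)‖) ^ 2 := by
            gcongr; exact norm_act_le _ _
        _ ≤ (absB p * C * Real.exp (-a * |x|)) *
            (condNumber P ^ 2 * (C / absB p) * (2 / a) * ‖u‖ ^ 2) := by
          rw [mul_pow]
          gcongr
          exact norm_matRr_sq_le_exp hp hR x
        _ = _ := by ring)
    (C := 2 * C * condNumber P / a)
    (by have := condNumber_nonneg P; positivity)
    (fun u => by
      rw [integral_const_mul_exp_neg_mul_abs ha]
      refine le_of_eq ?_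
      field_simp)
  refine ⟨K, fun u => ?_⟩
  filter_upwards [hK u] with x hx
  rw [hx]
  simp only [act_mul, hA]

/-- The Birman-Schwinger operator is Hilbert-Schmidt. -/
lemma IsBirmanSchwinger.hsNormSq_le (hp : (p.D, p.β) ≠ (0, 0)) (hψ : Measurable ψ) (ha : 0 < a)
    (hR : ∀ x, ‖matR p ψ x‖ ≤ C * Real.exp (-a * |x|))
    (hP : IsEigenvectorMatrix (matA p lam) P) {K : L2 I4 →L[ℂ] L2 I4}
    (hK : IsBirmanSchwinger p ψ lam K) :
    hsNormSq K ≤ ENNReal.ofReal (16 * C ^ 2 * condNumber P ^ 2 / a ^ 2) := by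
  have hC := nonneg_of_norm_matR_le hR
  have h0 := absB_pos hp
  have hgi := (integrable_exp_neg_mul_abs ha).const_mul (condNumber P ^ 2 * (C / absB p))
  refine iSup₂_le fun n v => ?_
  have h1 : ∑ i, ‖K (v.1 i)‖ ^ 2 ≤ 16 * C ^ 2 * condNumber P ^ 2 / a ^ 2 := by
    simp_rw [norm_sq_eq_integral]
    rw [← integral_finsetSum _ fun i _ => integrable_norm_sq _]
    -- For almost every fixed `x`, Bessel in `y` bounds the whole family at once. The 4 is the
    -- cardinality of `I4`; integrating in `x` then yields `4 (2 / a)² = 16 / a²`.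
    have h2 : ∀ᵐ x, ∑ i, ‖K (v.1 i) x‖ ^ 2 ≤
        (absB p * C * (4 * (condNumber P ^ 2 * (C / absB p) * (2 / a)))) *
          Real.exp (-a * |x|) := by
      filter_upwards [ae_all_iff.2 fun i => hK (v.1 i)] with x hx
      have h3 := sum_norm_integral_act_sq_le (measurable_greenKernel_mul_matRl hψ hP x) hgi
        (norm_greenKernel_mul_matRl_sq_le hp hR hP x) v.2
      rw [integral_const_mul_exp_neg_mul_abs ha] at h3
      simp only [act_mul] at h3
      calc ∑ i, ‖K (v.1 i) x‖ ^ 2 ≤ ∑ i, ‖matRr p ψ x‖ ^ 2 *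
            ‖∫ y, act (greenKernel (matA p lam) (x - y)) (act (matRl p ψ y) (v.1 i y))‖ ^ 2 := by
            refine Finset.sum_le_sum fun i _ => ?_
            rw [hx i, ← mul_pow]
            gcongr
            exact norm_act_le _ _
        _ ≤ (absB p * C * Real.exp (-a * |x|)) *
            (4 * (condNumber P ^ 2 * (C / absB p) * (2 / a))) := by
            rw [← Finset.mul_sum]
            refine mul_le_mul (norm_matRr_sq_le_exp hp hR x) ?_ (by positivity) (by positivity)
            simpa using h3
        _ = _ := by ring
    refine (integral_mono_ae (integrable_finsetSum _ fun i _ => integrable_norm_sq _)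
      ((integrable_exp_neg_mul_abs ha).const_mul _) h2).trans_eq ?_
    rw [integral_const_mul_exp_neg_mul_abs ha]
    field_simp
    ring
  refine le_trans (le_of_eq ?_) (ENNReal.ofReal_le_ofReal h1)
  rw [ENNReal.ofReal_sum_of_nonneg fun _ _ => by positivity]
  refine Finset.sum_congr rfl fun i _ => ?_
  rw [ENNReal.ofReal_pow (norm_nonneg _), ofReal_norm]

end BirmanSchwinger

end CGLE

end
noncomputable section

namespace CGLE

/-! ### Weak derivatives of test functions -/

section TestVectors

variable {n : Type} [Fintype n]

lemma memLp_smul_const {g : ℝ → ℝ} (hg : Continuous g) (hc : HasCompactSupport g)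
    (c : EuclideanSpace ℂ n) : MemLp (fun x => g x • c) 2 volume :=
  (hg.smul continuous_const).memLp_of_hasCompactSupport hc.smul_right

/-- The element `x ↦ g(x) c` of `L²`. -/
def testVec {g : ℝ → ℝ} (hg : Continuous g) (hc : HasCompactSupport g)
    (c : EuclideanSpace ℂ n) : L2 n :=
  (memLp_smul_const hg hc c).toLp _

lemma coeFn_testVec {g : ℝ → ℝ} (hg : Continuous g) (hc : HasCompactSupport g)
    (c : EuclideanSpace ℂ n) : testVec hg hc c =ᵐ[volume] fun x => g x • c :=
  (memLp_smul_const hg hc c).coeFn_toLp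

lemma inner_testVec {g : ℝ → ℝ} (hg : Continuous g) (hc : HasCompactSupport g)
    (c : EuclideanSpace ℂ n) (u : L2 n) :
    inner ℂ (testVec hg hc c) u = inner ℂ c (∫ x, g x • u x) := by
  rw [← integral_inner (integrable_test_smul u hg hc), L2.inner_def]
  refine integral_congr_ae ?_
  filter_upwards [coeFn_testVec hg hc c] with x hx
  rw [hx, inner_smul_left_eq_smul, inner_smul_right_eq_smul]

/-- Scalar conditions that are visibly continuous in `(u, v)`; closedness of the weak derivative,
and with it completeness of `H²`, follows. -/
lemma hasWeakDeriv_iff_inner {u v : L2 n} : HasWeakDeriv u v ↔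
    ∀ (φ : ℝ → ℝ) (hφ : ContDiff ℝ ∞ φ) (hc : HasCompactSupport φ) (c : EuclideanSpace ℂ n),
      inner ℂ (testVec (hφ.continuous_deriv (by simp)) hc.deriv c) u =
        -inner ℂ (testVec hφ.continuous hc c) v := by
  simp only [inner_testVec, ← inner_neg_right]
  refine ⟨fun h φ hφ hc c => by rw [h φ hφ hc], fun h φ hφ hc => ext_inner_left ℂ (h φ hφ hc)⟩

lemma isClosed_setOf_hasWeakDeriv : IsClosed {z : L2 n × L2 n | HasWeakDeriv z.1 z.2} := by
  simp only [hasWeakDeriv_iff_inner, Set.ofPred_forall]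
  refine isClosed_iInter fun φ => isClosed_iInter fun hφ => isClosed_iInter fun hc =>
    isClosed_iInter fun c => isClosed_eq ?_ ?_
  · exact Continuous.inner continuous_const continuous_fst
  · exact (Continuous.inner continuous_const continuous_snd).neg

lemma hasWeakDeriv_testVec {g : ℝ → ℝ} (hg : ContDiff ℝ ∞ g) (hc : HasCompactSupport g)
    (c : EuclideanSpace ℂ n) :
    HasWeakDeriv (testVec hg.continuous hc c)
      (testVec (hg.continuous_deriv (by simp)) hc.deriv c) := by
  intro φ hφ hφc
  have hg' := hg.continuous_deriv (by simp)
  have hφ' := hφ.continuous_deriv (by simp)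
  have e : ∀ {k h : ℝ → ℝ} (hk : Continuous k) (hkc : HasCompactSupport k),
      ∫ x, h x • testVec hk hkc c x = (∫ x, h x * k x) • c := by
    intro k h hk hkc
    rw [← integral_smul_const]
    refine integral_congr_ae ?_
    filter_upwards [coeFn_testVec hk hkc c] with x hx
    rw [hx, smul_smul]
  rw [e, e, ← neg_smul]
  congr 1
  rw [eq_neg_iff_add_eq_zero, add_comm, ← eq_neg_iff_add_eq_zero]
  exact integral_mul_deriv_eq_deriv_mul_of_integrable
    (fun x _ => (hφ.differentiable (by simp) x).hasDerivAt)
    (fun x _ => (hg.differentiable (by simp) x).hasDerivAt)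
    ((hφ.continuous.mul hg').integrable_of_hasCompactSupport hφc.mul_right)
    ((hφ'.mul hg.continuous).integrable_of_hasCompactSupport hc.mul_left)
    ((hφ.continuous.mul hg.continuous).integrable_of_hasCompactSupport hφc.mul_right)

lemma norm_testVec_sq {g : ℝ → ℝ} (hg : Continuous g) (hc : HasCompactSupport g)
    (c : EuclideanSpace ℂ n) : ‖testVec hg hc c‖ ^ 2 = (∫ x, g x ^ 2) * ‖c‖ ^ 2 := by
  rw [norm_sq_eq_integral, ← integral_mul_const]
  refine integral_congr_ae ?_
  filter_upwards [coeFn_testVec hg hc c] with x hx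
  rw [hx, norm_smul, mul_pow, Real.norm_eq_abs, sq_abs]

end TestVectors

/-! ### Operators with closed range and finite dimensional kernel -/

/-- By the open mapping theorem onto the closed range, `T x_n` has preimages `y_n → 0`. Then `x_n -
y_n` lies in the kernel, its image under `π` is bounded in the finite dimensional `V`, and
Bolzano-Weierstrass applies. -/
lemma exists_tendsto_subseq_of_isClosed_range {X Y Z : Type*} [NormedAddCommGroup X]
    [NormedSpace ℂ X] [CompleteSpace X] [NormedAddCommGroup Y] [NormedSpace ℂ Y] [CompleteSpace Y]
    [NormedAddCommGroup Z] [NormedSpace ℂ Z] (T : X →L[ℂ] Y)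
    (hT : IsClosed (LinearMap.range (T : X →ₗ[ℂ] Y) : Set Y)) (π : X →L[ℂ] Z)
    (V : Submodule ℂ Z) [FiniteDimensional ℂ V] (hV : ∀ x, T x = 0 → π x ∈ V)
    {x : ℕ → X} (hx : Tendsto (fun n => T (x n)) atTop (𝓝 0)) {C : ℝ}
    (hC : ∀ n, ‖π (x n)‖ ≤ C) :
    ∃ (z : Z) (φ : ℕ → ℕ), StrictMono φ ∧ Tendsto (fun n => π (x (φ n))) atTop (𝓝 z) := by
  have : CompleteSpace (LinearMap.range (T : X →ₗ[ℂ] Y)) := hT.completeSpace_coe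
  let T' : X →L[ℂ] LinearMap.range (T : X →ₗ[ℂ] Y) :=
    T.codRestrict _ fun x => LinearMap.mem_range_self (T : X →ₗ[ℂ] Y) x
  obtain ⟨c, hc0, hc⟩ := T'.exists_preimage_norm_le fun ⟨y, x, hx⟩ => ⟨x, Subtype.ext hx⟩
  choose y hy hyn using fun n => hc (T' (x n))
  have hy' : ∀ n, T (y n) = T (x n) := fun n => congrArg Subtype.val (hy n)
  have hy0 : Tendsto y atTop (𝓝 0) := by
    refine squeeze_zero_norm hyn ?_
    have h := hx.norm.const_mul c
    rw [norm_zero, mul_zero] at h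
    exact h
  have hπy : Tendsto (fun n => π (y n)) atTop (𝓝 0) := by
    have h := (π.continuous.tendsto 0).comp hy0
    rw [map_zero] at h
    exact h
  let k : ℕ → V := fun n => ⟨π (x n - y n), hV _ (by rw [map_sub, hy', sub_self])⟩
  obtain ⟨D, hD⟩ := hπy.norm.bddAbove_range
  have hk : ∀ n, k n ∈ Metric.closedBall (0 : V) (C + D) := by
    intro n
    rw [mem_closedBall_zero_iff]
    calc ‖k n‖ = ‖π (x n - y n)‖ := rfl
      _ ≤ ‖π (x n)‖ + ‖π (y n)‖ := by rw [map_sub]; exact norm_sub_le _ _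
      _ ≤ C + D := add_le_add (hC n) (hD ⟨n, rfl⟩)
  have : ProperSpace V := FiniteDimensional.proper ℂ V
  obtain ⟨v, -, φ, hφ, hv⟩ := (isCompact_closedBall (0 : V) (C + D)).tendsto_subseq hk
  refine ⟨v, φ, hφ, ?_⟩
  have h1 := ((continuous_subtype_val.tendsto v).comp hv).add (hπy.comp hφ.tendsto_atTop)
  rw [add_zero] at h1
  refine h1.congr fun n => ?_
  simp [k]

/-! ### The spectral parameters where `A_∞` is singular belong to the essential spectrum -/

section Weyl

lemma fredholm_of_notMem_essentialSpectrum {H : Type*} [NormedAddCommGroup H] [NormedSpace ℂ H]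
    {T : H →ₗ.[ℂ] H} {lam : ℂ} (h : lam ∉ essentialSpectrum T) :
    FiniteDimensional ℂ (LinearMap.ker (shift T lam)) ∧
      IsClosed (LinearMap.range (shift T lam) : Set H) := by
  by_cases hr : lam ∈ resolventSet T
  · obtain ⟨S, hS, hS'⟩ := hr
    have hk : LinearMap.ker (shift T lam) = ⊥ := by
      rw [LinearMap.ker_eq_bot']
      intro q hq
      have := hS q
      rw [hq, map_zero] at this
      exact Subtype.ext this.symm
    have hR : LinearMap.range (shift T lam) = ⊤ := by
      rw [LinearMap.range_eq_top]
      intro f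
      obtain ⟨h, hf⟩ := hS' f
      exact ⟨_, hf⟩
    rw [hk, hR]
    exact ⟨inferInstance, isClosed_univ⟩
  · have : lam ∈ fredholmPointSpectrum T := by
      by_contra hn
      exact h ⟨hr, hn⟩
    exact ⟨this.1, this.2.1⟩

/-! ### The operator on `H²` and its Weyl sequences. -/

variable (p : Params) (ψ : ℝ → ℂ) (lam : ℂ)

/-- The Sobolev space `H²`, realized as the space of triples `(q, q', q'')`. -/
def sobolevTriples : Submodule ℂ (L2 (Fin 2) × L2 (Fin 2) × L2 (Fin 2)) where
  carrier := {z | HasWeakDeriv z.1 z.2.1 ∧ HasWeakDeriv z.2.1 z.2.2}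
  add_mem' h h' := ⟨h.1.add h'.1, h.2.add h'.2⟩
  zero_mem' := ⟨.zero, .zero⟩
  smul_mem' c _ h := ⟨h.1.smul c, h.2.smul c⟩

lemma isClosed_sobolevTriples :
    IsClosed (sobolevTriples : Set (L2 (Fin 2) × L2 (Fin 2) × L2 (Fin 2))) :=
  (isClosed_setOf_hasWeakDeriv.preimage
    (continuous_fst.prodMk (continuous_fst.comp continuous_snd))).inter
  (isClosed_setOf_hasWeakDeriv.preimage continuous_snd)

variable {p ψ lam}

/-- `T` is the operator `ℒ - lam` on the space of triples. -/
lemma exists_clm_shift {Cm : ℝ} (hψ : Measurable ψ) (hM : ∀ x, ‖matM p ψ x‖ ≤ Cm) :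
    ∃ T : sobolevTriples →L[ℂ] L2 (Fin 2), ∀ z : sobolevTriples, ∀ᵐ x,
      T z x = act (matB p) (z.1.2.2 x) + act (matMtilde p ψ x - lam • 1) (z.1.1 x) := by
  have hMt : ∀ x, matMtilde p ψ x - lam • 1 = matM p ψ x + (matN0 p - lam • 1) := fun x => by
    rw [matM]; abel
  obtain ⟨TB, hTB⟩ := exists_clm_act (A := fun _ => matB p) (fun _ _ => measurable_const)
    fun _ => le_rfl
  obtain ⟨TM, hTM⟩ := exists_clm_act (A := fun x => matMtilde p ψ x - lam • 1)
    (C := Cm + ‖matN0 p - lam • 1‖)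
    (fun i j => by
      simp only [hMt, Matrix.add_apply]
      exact (measurable_matM hψ i j).add_const _)
    (fun x => by
      rw [hMt]
      exact (norm_add_le _ _).trans (by gcongr; exact hM x))
  refine ⟨(TB ∘L .snd ℂ _ _ ∘L .snd ℂ _ _ + TM ∘L .fst ℂ _ _) ∘L sobolevTriples.subtypeL, ?_⟩
  intro z
  filter_upwards [hTB z.1.2.2, hTM z.1.1, Lp.coeFn_add (TB z.1.2.2) (TM z.1.1)] with x h1 h2 h3
  rw [← h1, ← h2]
  exact h3

/-- With `exists_triple_eq`, this transfers kernel and range of the unbounded `ℒ - lam` to the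
bounded `T` on a Banach space, where the open mapping theorem is available. -/
lemma exists_shift_eq {T : sobolevTriples →L[ℂ] L2 (Fin 2)}
    (hT : ∀ z : sobolevTriples, ∀ᵐ x,
      T z x = act (matB p) (z.1.2.2 x) + act (matMtilde p ψ x - lam • 1) (z.1.1 x))
    (z : sobolevTriples) : ∃ q : (opL p ψ).domain, (q : L2 (Fin 2)) = z.1.1 ∧
      shift (opL p ψ) lam q = T z := by
  have h : (z.1.1, T z + lam • z.1.1) ∈ (opL p ψ).graph := by
    rw [opL_graph]
    refine ⟨z.1.2.1, z.1.2.2, z.2.1, z.2.2, ?_⟩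
    filter_upwards [hT z, Lp.coeFn_add (T z) (lam • z.1.1), Lp.coeFn_smul lam z.1.1]
      with x h1 h2 h3
    rw [h2, Pi.add_apply, h3, Pi.smul_apply, h1, act_sub]
    simp only [act, map_smul, map_one, _root_.smul_apply,
      one_apply_eq_self]
    abel
  obtain ⟨q, hq, hq'⟩ := LinearPMap.mem_graph_iff _ |>.1 h
  refine ⟨q, hq, ?_⟩
  have : shift (opL p ψ) lam q = opL p ψ q - lam • (q : L2 (Fin 2)) := rfl
  rw [this, hq', hq, add_sub_cancel_right]

lemma exists_triple_eq {T : sobolevTriples →L[ℂ] L2 (Fin 2)}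
    (hT : ∀ z : sobolevTriples, ∀ᵐ x,
      T z x = act (matB p) (z.1.2.2 x) + act (matMtilde p ψ x - lam • 1) (z.1.1 x))
    (q : (opL p ψ).domain) : ∃ z : sobolevTriples, T z = shift (opL p ψ) lam q := by
  have h := (opL p ψ).mem_graph q
  rw [opL_graph] at h
  obtain ⟨q₁, q₂, h1, h2, h3⟩ := h
  refine ⟨⟨(q, q₁, q₂), h1, h2⟩, Lp.ext ?_⟩
  have : shift (opL p ψ) lam q = opL p ψ q - lam • (q : L2 (Fin 2)) := rfl
  rw [this]
  filter_upwards [hT ⟨(q, q₁, q₂), h1, h2⟩, h3, Lp.coeFn_sub (opL p ψ q) (lam • (q : L2 (Fin 2))),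
    Lp.coeFn_smul lam (q : L2 (Fin 2))] with x h4 h5 h6 h7
  rw [h4, h6, Pi.sub_apply, h7, Pi.smul_apply, h5, act_sub]
  simp [act, add_sub_assoc]

/-- The scaled function `x ↦ ε f(ε² x)`, whose `L²` norm does not depend on `ε`. -/
def rescale (f : ℝ → ℝ) (ε : ℝ) (x : ℝ) : ℝ := ε * f (ε ^ 2 * x)

lemma rescale_contDiff {f : ℝ → ℝ} (hf : ContDiff ℝ ∞ f) (ε : ℝ) : ContDiff ℝ ∞ (rescale f ε) :=
  contDiff_const.mul (hf.comp (contDiff_const.mul contDiff_id))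

lemma rescale_hasCompactSupport {f : ℝ → ℝ} (hf : HasCompactSupport f) {ε : ℝ} (hε : ε ≠ 0) :
    HasCompactSupport (rescale f ε) :=
  (hf.comp_homeomorph (Homeomorph.mulLeft₀ (ε ^ 2) (pow_ne_zero 2 hε))).mul_left

lemma deriv_rescale {f : ℝ → ℝ} (ε : ℝ) :
    deriv (rescale f ε) = fun x => ε ^ 2 * rescale (deriv f) ε x := by
  ext x
  have : rescale f ε = fun x => ε * f (ε ^ 2 * x) := rfl
  rw [this, deriv_const_mul_field']
  beta_reduce
  rw [deriv_comp_mul_left (ε ^ 2) f x]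
  simp only [rescale, smul_eq_mul]
  ring

lemma integral_rescale_sq (f : ℝ → ℝ) {ε : ℝ} (hε : ε ≠ 0) :
    ∫ x, rescale f ε x ^ 2 = ∫ x, f x ^ 2 := by
  simp only [rescale, mul_pow]
  rw [integral_const_mul, Measure.integral_comp_mul_left (fun x => f x ^ 2) (ε ^ 2), abs_inv,
    abs_of_nonneg (sq_nonneg ε), smul_eq_mul, mul_inv_cancel_left₀ (pow_ne_zero 2 hε)]

lemma deriv_deriv_rescale {f : ℝ → ℝ} (ε : ℝ) :
    deriv (deriv (rescale f ε)) = fun x => ε ^ 4 * rescale (deriv (deriv f)) ε x := by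
  rw [deriv_rescale]
  ext x
  rw [deriv_const_mul_field', deriv_rescale]
  beta_reduce
  ring

/-- The triple `(q, q', q'')` for `q(x) = g(x) e`. -/
def testTriple {g : ℝ → ℝ} (hg : ContDiff ℝ ∞ g) (hc : HasCompactSupport g)
    (e : EuclideanSpace ℂ (Fin 2)) : sobolevTriples :=
  ⟨(testVec hg.continuous hc e, testVec (hg.continuous_deriv (by simp)) hc.deriv e,
    testVec ((contDiff_infty_iff_deriv.1 hg).2.continuous_deriv (by simp)) hc.deriv.deriv e),
    hasWeakDeriv_testVec hg hc e,
    hasWeakDeriv_testVec (contDiff_infty_iff_deriv.1 hg).2 hc.deriv e⟩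

/-- Since `e` is killed by `N₀ - lam`, only `g'' B e` and `g M e` survive. The first is small
because the profile is flat, the second because `|g| ≤ ε` and `M` is square integrable. -/
lemma norm_shift_testTriple_sq_le {T : sobolevTriples →L[ℂ] L2 (Fin 2)}
    (hT : ∀ z : sobolevTriples, ∀ᵐ x,
      T z x = act (matB p) (z.1.2.2 x) + act (matMtilde p ψ x - lam • 1) (z.1.1 x))
    {b a : ℝ} (ha : 0 < a) (hM : ∀ x, ‖matM p ψ x‖ ≤ b * Real.exp (-a * |x|))
    {e : EuclideanSpace ℂ (Fin 2)} (he : act (matN0 p - lam • 1) e = 0)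
    {f : ℝ → ℝ} (hf : ContDiff ℝ ∞ f) (hfc : HasCompactSupport f) (hf1 : ∀ x, |f x| ≤ 1)
    {ε : ℝ} (hε : 0 < ε) (hε1 : ε ≤ 1) :
    ‖T (testTriple (rescale_contDiff hf ε) (rescale_hasCompactSupport hfc hε.ne') e)‖ ^ 2 ≤
      ε ^ 2 * (2 * ‖act (matB p) e‖ ^ 2 * (∫ x, deriv (deriv f) x ^ 2) +
        2 * b ^ 2 * ‖e‖ ^ 2 * (2 / (2 * a))) := by
  set z := testTriple (rescale_contDiff hf ε) (rescale_hasCompactSupport hfc hε.ne') e with hz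
  have hb : 0 ≤ b := by simpa using (norm_nonneg _).trans (hM 0)
  have hg := rescale_contDiff hf ε
  have hgc := rescale_hasCompactSupport hfc hε.ne'
  have hg2 : Continuous (deriv (deriv (rescale f ε))) :=
    (contDiff_infty_iff_deriv.1 hg).2.continuous_deriv (by simp)
  have hi2 : Integrable fun x => deriv (deriv (rescale f ε)) x ^ 2 := by
    have := (hg2.mul hg2).integrable_of_hasCompactSupport (μ := volume)
      hgc.deriv.deriv.mul_left
    exact this.congr (.of_forall fun x => (sq _).symm)
  have hptw : ∀ᵐ x, ‖T z x‖ ^ 2 ≤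
      2 * ‖act (matB p) e‖ ^ 2 * deriv (deriv (rescale f ε)) x ^ 2 +
        2 * b ^ 2 * ‖e‖ ^ 2 * ε ^ 2 * Real.exp (-(2 * a) * |x|) := by
    filter_upwards [hT z, coeFn_testVec hg.continuous hgc e,
      coeFn_testVec hg2 hgc.deriv.deriv e] with x h1 h2 h3
    have h2' : z.1.1 x = rescale f ε x • e := h2
    have h3' : z.1.2.2 x = deriv (deriv (rescale f ε)) x • e := h3
    have hMe : act (matMtilde p ψ x - lam • 1) e = act (matM p ψ x) e := by
      have : matMtilde p ψ x - lam • 1 = matM p ψ x + (matN0 p - lam • 1) := by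
        rw [matM]; abel
      rw [this, act_add, he, add_zero]
    have hsm : ∀ (A : Matrix (Fin 2) (Fin 2) ℂ) (r : ℝ), act A (r • e) = r • act A e :=
      fun A r => by
        rw [← Complex.coe_smul, act_map_smul, Complex.coe_smul]
    rw [h1, h2', h3', hsm, hsm, hMe]
    have hr : |rescale f ε x| ≤ ε := by
      rw [rescale, abs_mul, abs_of_pos hε]
      exact mul_le_of_le_one_right hε.le (hf1 _)
    have hn : ‖act (matM p ψ x) e‖ ≤ b * Real.exp (-a * |x|) * ‖e‖ :=
      (norm_act_le _ _).trans (by gcongr; exact hM x)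
    have hexp : Real.exp (-(2 * a) * |x|) = Real.exp (-a * |x|) ^ 2 := by
      rw [← Real.exp_nat_mul]; congr 1; push_cast; ring
    set r := deriv (deriv (rescale f ε)) x
    set s := rescale f ε x
    calc ‖r • act (matB p) e + s • act (matM p ψ x) e‖ ^ 2
        ≤ (|r| * ‖act (matB p) e‖ + ε * (b * Real.exp (-a * |x|) * ‖e‖)) ^ 2 := by
          gcongr
          refine (norm_add_le _ _).trans ?_
          rw [norm_smul, norm_smul, Real.norm_eq_abs, Real.norm_eq_abs]
          gcongr
      _ ≤ 2 * (|r| * ‖act (matB p) e‖) ^ 2 + 2 * (ε * (b * Real.exp (-a * |x|) * ‖e‖)) ^ 2 := by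
          nlinarith [sq_nonneg (|r| * ‖act (matB p) e‖ - ε * (b * Real.exp (-a * |x|) * ‖e‖))]
      _ = _ := by rw [hexp, ← sq_abs r]; ring
  have hi3 := (integrable_exp_neg_mul_abs (a := 2 * a) (by positivity)).const_mul
    (2 * b ^ 2 * ‖e‖ ^ 2 * ε ^ 2)
  have hi4 := hi2.const_mul (2 * ‖act (matB p) e‖ ^ 2)
  have hI : 0 ≤ ∫ x, deriv (deriv f) x ^ 2 := integral_nonneg fun x => sq_nonneg _
  have hI2 : ∫ x, deriv (deriv (rescale f ε)) x ^ 2 ≤ ε ^ 2 * ∫ x, deriv (deriv f) x ^ 2 := by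
    rw [deriv_deriv_rescale]
    simp only [mul_pow]
    rw [integral_const_mul, integral_rescale_sq _ hε.ne', ← pow_mul]
    gcongr ?_ * _
    -- Two derivatives produce `ε⁴`, hence `ε⁸` after squaring, and `ε⁸ ≤ ε²`.
    exact pow_le_pow_of_le_one hε.le hε1 (by norm_num)
  rw [norm_sq_eq_integral]
  calc ∫ x, ‖T z x‖ ^ 2 ≤ _ := integral_mono_ae (integrable_norm_sq _) (hi4.add hi3) hptw
    _ = 2 * ‖act (matB p) e‖ ^ 2 * (∫ x, deriv (deriv (rescale f ε)) x ^ 2) +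
        2 * b ^ 2 * ‖e‖ ^ 2 * ε ^ 2 * (2 / (2 * a)) := by
      simp only [Pi.add_apply]
      rw [integral_add hi4 hi3, integral_const_mul,
        integral_const_mul_exp_neg_mul_abs (by positivity)]
    _ ≤ 2 * ‖act (matB p) e‖ ^ 2 * (ε ^ 2 * ∫ x, deriv (deriv f) x ^ 2) +
        2 * b ^ 2 * ‖e‖ ^ 2 * ε ^ 2 * (2 / (2 * a)) := by gcongr
    _ = _ := by ring

/-- If a sequence of test vectors with uniformly vanishing profiles converges in `L²`, its limit
is zero. -/
lemma eq_zero_of_tendsto_testVec {n : Type} [Fintype n] {g : ℕ → ℝ → ℝ}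
    (hg : ∀ k, Continuous (g k)) (hc : ∀ k, HasCompactSupport (g k)) (e : EuclideanSpace ℂ n)
    (h0 : ∀ x, Tendsto (fun k => g k x) atTop (𝓝 0)) {w : L2 n}
    (hw : Tendsto (fun k => testVec (hg k) (hc k) e) atTop (𝓝 w)) : w = 0 := by
  obtain ⟨φ, hφ, hae⟩ := (tendstoInMeasure_of_tendsto_Lp hw).exists_seq_tendsto_ae
  refine Lp.ext ?_
  filter_upwards [hae, ae_all_iff.2 fun k => coeFn_testVec (hg k) (hc k) e,
    Lp.coeFn_zero (EuclideanSpace ℂ n) 2 (volume : Measure ℝ)] with x h1 h2 h3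
  rw [h3, Pi.zero_apply]
  refine tendsto_nhds_unique h1 ?_
  simp only [h2]
  simpa using ((h0 x).comp hφ.tendsto_atTop).smul_const e

/-- Outside the essential spectrum of `ℒ` the matrix `lam - N₀` is invertible. -/
lemma det_ne_zero_of_notMem_essentialSpectrum (hψ : Measurable ψ)
    {b a : ℝ} (ha : 0 < a) (hM : ∀ x, ‖matM p ψ x‖ ≤ b * Real.exp (-a * |x|))
    (h : lam ∉ essentialSpectrum (opL p ψ)) :
    (lam • (1 : Matrix (Fin 2) (Fin 2) ℂ) - matN0 p).det ≠ 0 := by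
  intro hdet
  obtain ⟨v, hv0, hv⟩ := Matrix.exists_mulVec_eq_zero_iff.2 hdet
  let e : EuclideanSpace ℂ (Fin 2) := WithLp.toLp 2 v
  have he0 : e ≠ 0 := fun h => hv0 (congrArg WithLp.ofLp h)
  have he : act (matN0 p - lam • 1) e = 0 := by
    have h1 : (matN0 p - lam • 1) *ᵥ v = 0 := by
      rw [← neg_sub, Matrix.neg_mulVec, hv, neg_zero]
    have h2 : act (matN0 p - lam • 1) e = WithLp.toLp 2 ((matN0 p - lam • 1) *ᵥ v) := by
      ext i
      rw [act_apply]
      rfl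
    rw [h2, h1]
    rfl
  have hb : 0 ≤ b := by simpa using (norm_nonneg _).trans (hM 0)
  have hM' : ∀ x, ‖matM p ψ x‖ ≤ b := fun x => (hM x).trans <|
    mul_le_of_le_one_right hb (Real.exp_le_one_iff.2 (by nlinarith [abs_nonneg x]))
  obtain ⟨hker, hrange⟩ := fredholm_of_notMem_essentialSpectrum h
  obtain ⟨T, hT⟩ := exists_clm_shift (lam := lam) hψ hM'
  have hTr : LinearMap.range (T : sobolevTriples →ₗ[ℂ] L2 (Fin 2)) =
      LinearMap.range (shift (opL p ψ) lam) := by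
    refine le_antisymm ?_ ?_
    · rintro _ ⟨z, rfl⟩
      obtain ⟨q, -, hq⟩ := exists_shift_eq hT z
      exact ⟨q, hq⟩
    · rintro _ ⟨q, rfl⟩
      obtain ⟨z, hz⟩ := exists_triple_eq hT q
      exact ⟨z, hz⟩
  -- The kernel of `ℒ - lam`, viewed in `L²`; it contains the first components of the kernel of `T`.
  let V : Submodule ℂ (L2 (Fin 2)) :=
    (LinearMap.ker (shift (opL p ψ) lam)).map (opL p ψ).domain.subtype
  have hVfin : FiniteDimensional ℂ V := inferInstance
  let π : sobolevTriples →L[ℂ] L2 (Fin 2) := .fst ℂ _ _ ∘L sobolevTriples.subtypeL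
  have hV : ∀ z, T z = 0 → π z ∈ V := by
    intro z hz
    obtain ⟨q, hq, hq'⟩ := exists_shift_eq hT z
    exact ⟨q, by rw [SetLike.mem_coe, LinearMap.mem_ker, hq', hz], hq⟩
  have : CompleteSpace sobolevTriples := isClosed_sobolevTriples.completeSpace_coe
  let f : ContDiffBump (0 : ℝ) := ⟨1, 2, one_pos, one_lt_two⟩
  have hf : ContDiff ℝ ∞ f := f.contDiff
  have hf1 : ∀ x, |f x| ≤ 1 := fun x => by rw [abs_of_nonneg f.nonneg]; exact f.le_one
  let ε : ℕ → ℝ := fun k => 1 / ((k : ℝ) + 1)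
  have hε : ∀ k, 0 < ε k := fun k => by positivity
  have hε1 : ∀ k, ε k ≤ 1 := fun k => by
    refine (div_le_one (by positivity)).2 ?_
    linarith [k.cast_nonneg (α := ℝ)]
  have hεlim : Tendsto ε atTop (𝓝 0) := tendsto_one_div_add_atTop_nhds_zero_nat
  have hc := fun k => rescale_hasCompactSupport f.hasCompactSupport (hε k).ne'
  let z : ℕ → sobolevTriples := fun k => testTriple (rescale_contDiff hf (ε k)) (hc k) e
  have hTz : Tendsto (fun k => T (z k)) atTop (𝓝 0) := by
    set c := 2 * ‖act (matB p) e‖ ^ 2 * (∫ x, deriv (deriv f) x ^ 2) +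
        2 * b ^ 2 * ‖e‖ ^ 2 * (2 / (2 * a)) with hc
    have h1 : ∀ k, ‖T (z k)‖ ≤ ε k * √c := by
      intro k
      refine Real.le_sqrt_of_sq_le (norm_shift_testTriple_sq_le hT ha hM he hf
        f.hasCompactSupport hf1 (hε k) (hε1 k)) |>.trans_eq ?_
      rw [Real.sqrt_mul (by positivity), Real.sqrt_sq (hε k).le]
    refine squeeze_zero_norm h1 ?_
    simpa using hεlim.mul_const (√c)
  have hπz : ∀ k, ‖π (z k)‖ ^ 2 = (∫ x, f x ^ 2) * ‖e‖ ^ 2 := by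
    intro k
    rw [← integral_rescale_sq f (hε k).ne']
    exact norm_testVec_sq (rescale_contDiff hf (ε k)).continuous (hc k) e
  have hpos : 0 < (∫ x, f x ^ 2) * ‖e‖ ^ 2 := by
    refine mul_pos ?_ (by positivity)
    have h1 : HasCompactSupport fun x => f x ^ 2 := by
      simp only [sq]
      exact f.hasCompactSupport.mul_left (f' := f)
    refine (f.continuous.pow 2).integral_pos_of_hasCompactSupport_nonneg_nonzero h1
      (fun x => sq_nonneg _) (x := 0) ?_
    rw [f.one_of_mem_closedBall (by simp [f])]
    norm_num
  have hbd : ∀ k, ‖π (z k)‖ ≤ √((∫ x, f x ^ 2) * ‖e‖ ^ 2) := fun k =>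
    Real.le_sqrt_of_sq_le (hπz k).le
  obtain ⟨w, φ, hφ, hw⟩ := exists_tendsto_subseq_of_isClosed_range T (by rwa [hTr]) π V hV hTz hbd
  -- The contradiction: the profiles tend to 0 uniformly, forcing the limit to be 0, while rescaling
  -- keeps their `L²` norms at a fixed positive value.
  have hw0 : w = 0 := by
    refine eq_zero_of_tendsto_testVec (fun k => (rescale_contDiff hf (ε (φ k))).continuous)
      (fun k => hc (φ k)) e (fun x => ?_) hw
    refine squeeze_zero_norm (fun k => ?_) (hεlim.comp hφ.tendsto_atTop)
    rw [rescale, norm_mul, Real.norm_of_nonneg (hε _).le]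
    exact mul_le_of_le_one_right (hε _).le (hf1 _)
  have hlim := (hw.norm.pow 2)
  simp only [hπz, hw0, norm_zero] at hlim
  have := tendsto_nhds_unique hlim tendsto_const_nhds
  rw [zero_pow two_ne_zero] at this
  exact hpos.ne this

end Weyl

end CGLE

end
-- The determinant bound.
theorem theorem5p3 :
    ∃ Γ : ℝ, 0 < Γ ∧
      ∀ (p : Params) (_ : (p.D, p.β) ≠ (0, 0))
        (ψ : ℝ → ℂ) (_ : Measurable ψ)
        (C_R a_R : ℝ) (_ : 0 < a_R)
        (_ : ∀ x : ℝ, ‖matR p ψ x‖ ≤ C_R * Real.exp (-a_R * |x|))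
        (lam : ℂ) (_ : lam ∉ essentialSpectrum (opL p ψ)),
        IsEigenvectorMatrix (matA p lam) (matP p lam) ∧
        ∃ K : L2 I4 →L[ℂ] L2 I4,
          IsBirmanSchwinger p ψ lam K ∧ IsHilbertSchmidt K ∧
          ‖det2 K‖ ≤
            Real.exp (32 * Γ * C_R ^ 2 * condNumber (matP p lam) ^ 2 / a_R ^ 2) ∧
          ∀ P : Matrix I4 I4 ℂ, IsEigenvectorMatrix (matA p lam) P →
            ‖det2 K‖ ≤ Real.exp (32 * Γ * C_R ^ 2 * condNumber P ^ 2 / a_R ^ 2) := by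
  -- `32 Γ = 16`, the constant in the Hilbert-Schmidt bound.
  refine ⟨1 / 2, by norm_num, ?_⟩
  intro p hp ψ hψ C_R a_R ha hR lam hlam
  have hM : ∀ x, ‖matM p ψ x‖ ≤ absB p * C_R * Real.exp (-a_R * |x|) := fun x => by
    rw [norm_matM hp, mul_assoc]
    exact mul_le_mul_of_nonneg_left (hR x) (absB_pos hp).le
  have hP := isEigenvectorMatrix_matP hp
    (det_ne_zero_of_notMem_essentialSpectrum hψ ha hM hlam)
  obtain ⟨K, hK⟩ := exists_isBirmanSchwinger hp hψ ha hR hP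
  have hbound : ∀ P : Matrix I4 I4 ℂ, IsEigenvectorMatrix (matA p lam) P →
      ‖det2 K‖ ≤ Real.exp (32 * (1 / 2) * C_R ^ 2 * condNumber P ^ 2 / a_R ^ 2) := by
    intro P hP
    refine (norm_det2_le (by positivity)
      (hK.hsNormSq_le hp hψ ha hR hP)).trans_eq ?_
    norm_num
  exact ⟨hP, K, hK, (hK.hsNormSq_le hp hψ ha hR hP).trans_lt ENNReal.ofReal_lt_top,
    hbound _ hP, hbound⟩
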